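/- Let $K$ be a local field of characteristic $p>0$, that is, a field of characteristic $p$ complete with respect to a discrete valuation, and assume that its residue field $k$ is perfect. Identify $k$ with its image under the Teichmüller lift, the unique coefficient field of $K$. Let $\pi_K$ be a prime element of $K$, let $K_s$ be a separable closure of $K$, and let $\nu_K$ be the extension to $K_s$ of the valuation of $K$ normalized by $\nu_K(K^\times)=\mathbb Z$. For a finite totally ramified subextension $L/K$ of $K_s/K$ put $\nu_L=[L:K]\,\nu_K$, so that $\nu_L(L^\times)=\mathbb Z$. A ramification break of $L/K$ is a number of the form $\nu_L(\sigma(\pi_L)-\pi_L)-1$, where $\pi_L$ is a prime element of $L$ and $\sigma:L\to K_s$ is a $K$-embedding other than the inclusion. Two subextensions $L_1/K$ and $L_2/K$ are $k$-isomorphic if there is a field isomorphism $\sigma:L_1\to L_2$ such that $\sigma(K)=K$ and $\sigma$ induces the identity map on $k$. Let $b\in\frac1{p-1}\cdot(\mathbb N\smallsetminus p\mathbb N)$ and write $b=\frac{(m-1)p+\lambda}{p-1}$ with integers $m$ and $1\le\lambda\le p-1$. Let $\mathcal S_b$ be the set of $k$-isomorphism classes of totally ramified subextensions of $K_s/K$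 of degree $p$ with ramification break $b$. Let $R=\{\omega_i : i\in I\}\subset k^\times$ be a set of coset representatives for $k^\times/(k^\times)^{(p-1)b}$, and for each $\omega_i\in R$ let $\pi_i\in K_s$ be a root of the polynomial $X^p-\omega_i\pi_K^mX^\lambda-\pi_K$. Then each $K(\pi_i)/K$ is a totally ramified extension of degree $p$ with ramification break $b$, and the map which carries $\omega_i$ to the $k$-isomorphism class of $K(\pi_i)/K$ is a bijection from $R$ to $\mathcal S_b$. Furthermore, $K(\pi_i)/K$ is Galois if and only if $b\in\mathbb N\smallsetminus p\mathbb N$ and $\lambda\omega_i\in(k^\times)^{p-1}$. -/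

import Mathlib

open IsLocalRing Polynomial
open scoped IntermediateField

namespace LocalFieldExt

noncomputable section

/- Throughout, a local field with valuation ring `𝒪` is a field `K` with a valuation subring `𝒪`
that is a complete discrete valuation ring.  Its residue field is `ResidueField 𝒪`, and `Ks` is a
separable closure of `K`. -/

section Residue

variable {K : Type*} [Field K] (p : ℕ) [Fact p.Prime] [CharP K p] (𝒪 : ValuationSubring K)

/-- If `K` has characteristic `p`, so does the residue field. -/
theorem charP_residueField : CharP (ResidueField 𝒪) p := by
  have h0 : ((p : ℕ) : 𝒪) = 0 := Subtype.ext (by simp)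
  have h1 : ((p : ℕ) : ResidueField 𝒪) = 0 := by
    have h2 := congrArg (residue 𝒪) h0
    simpa using h2
  exact (CharP.charP_iff_prime_eq_zero (Fact.out : p.Prime)).mpr h1

variable [IsAdicComplete (maximalIdeal 𝒪) 𝒪] [PerfectField (ResidueField 𝒪)]

/-- The Teichmüller lift `k → 𝒪` of the perfect residue field `k`.  In characteristic `p` it is a
ring homomorphism and identifies `k` with the unique coefficient field of `K`; after the choice of
a prime element `π` this is the identification of `K` with `k((π))`. -/
def teichmuller : ResidueField 𝒪 →* 𝒪 :=
  haveI : CharP (ResidueField 𝒪) p := charP_residueField p 𝒪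
  haveI : CharP (𝒪 ⧸ maximalIdeal 𝒪) p := charP_residueField p 𝒪
  haveI : PerfectRing (ResidueField 𝒪) p := PerfectField.toPerfectRing p
  (Perfection.teichmuller p (maximalIdeal 𝒪)).comp
    (Perfection.lift p (ResidueField 𝒪) (ResidueField 𝒪) (RingHom.id _) :
      ResidueField 𝒪 →+* Perfection (ResidueField 𝒪) p).toMonoidHom

/-- The field automorphism `φ` of `K` is the identity on `k ⊆ K`. -/
def FixesResidueField (φ : K ≃+* K) : Prop :=
  ∀ a : ResidueField 𝒪, φ (teichmuller p 𝒪 a) = teichmuller p 𝒪 a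

variable {𝒪}

/-- The trinomial `X^p - ω π^m X^l - π` over `K`, for `ω ∈ k^×` and `π ∈ 𝒪`. -/
def amanoPolynomial (π : 𝒪) (m l : ℕ) (ω : (ResidueField 𝒪)ˣ) : K[X] :=
  X ^ p - C ((teichmuller p 𝒪 ω : K) * (π : K) ^ m) * X ^ l - C (π : K)

end Residue

section Ramification

variable {K Ks : Type*} [Field K] [Field Ks] [Algebra K Ks]
variable (𝒪 : ValuationSubring K) [IsDiscreteValuationRing 𝒪]

/-- The normalized additive valuation `K^× → ℤ` (with the value `0` at `0`, which is not used). -/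
def ordBase (x : K) : ℤ :=
  -WithZero.log ((IsDiscreteValuationRing.maximalIdeal 𝒪).valuation K x)

open Classical in
/-- The valuation `ν_K` of the separable closure `Ks`, normalized by `ν_K(K^×) = ℤ`: for `x ≠ 0`,
`ν_K(x) = ν_K(N_{K(x)/K}(x)) / [K(x) : K]`. -/
def ord (x : Ks) : WithTop ℚ :=
  if x = 0 then ⊤ else
    (((ordBase 𝒪 (Algebra.norm K (IntermediateField.AdjoinSimple.gen K x)) : ℚ) /
      (Module.finrank K K⟮x⟯ : ℚ) : ℚ) : WithTop ℚ)

/-- `L/K` is finite and totally ramified: `ν_K(L^×) = (1/[L:K])ℤ`, that is, the ramification index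
`(ν_K(L^×) : ν_K(K^×))` equals the degree. -/
def IsTotallyRamified (L : IntermediateField K Ks) : Prop :=
  FiniteDimensional K L ∧
    ∀ r : ℚ, (∃ x ∈ L, ord 𝒪 x = (r : WithTop ℚ)) ↔
      ∃ z : ℤ, r = (z : ℚ) / (Module.finrank K L : ℚ)

/-- The valuation `ν_L` of `Ks` attached to a totally ramified `L/K`, which is normalized by
`ν_L(L^×) = ℤ`. -/
def ordOf (L : IntermediateField K Ks) (x : Ks) : WithTop ℚ :=
  Module.finrank K L • ord 𝒪 x

/-- `b` is a (lower) ramification break of the totally ramified extension `L/K`: it is the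
ramification number `ν_L(σ(π_L) - π_L) - 1` of a `K`-embedding `σ : L → Ks` other than the
inclusion, where `π_L` is a prime element of `L`. -/
def IsRamificationBreak (L : IntermediateField K Ks) (b : ℚ) : Prop :=
  ∃ σ : L →ₐ[K] Ks, σ ≠ L.val ∧ ∃ π : L, ordOf 𝒪 L (π : Ks) = 1 ∧
    ordOf 𝒪 L (σ π - (π : Ks)) = ((b + 1 : ℚ) : WithTop ℚ)

variable (Ks)

/-- The totally ramified subextensions of `Ks/K` of degree `p` with ramification break `b`. -/
def extensionsWithBreak (p : ℕ) (b : ℚ) : Set (IntermediateField K Ks) :=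
  {L | Module.finrank K L = p ∧ IsTotallyRamified 𝒪 L ∧ IsRamificationBreak 𝒪 L b}

end Ramification

section Isomorphism

variable {K Ks : Type*} [Field K] [Field Ks] [Algebra K Ks]
variable (p : ℕ) [Fact p.Prime] [CharP K p] (𝒪 : ValuationSubring K)
variable [IsAdicComplete (maximalIdeal 𝒪) 𝒪] [PerfectField (ResidueField 𝒪)]

/-- `L₁/K` and `L₂/K` are `k`-isomorphic: there is a field isomorphism `σ : L₁ → L₂` with
`σ(K) = K` that induces the identity on `k`. -/
def IsKIsomorphic (L₁ L₂ : IntermediateField K Ks) : Prop :=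
  ∃ (σ : L₁ ≃+* L₂) (φ : K ≃+* K),
    (∀ x : K, σ (algebraMap K L₁ x) = algebraMap K L₂ (φ x)) ∧ FixesResidueField p 𝒪 φ

theorem IsKIsomorphic.refl (L : IntermediateField K Ks) : IsKIsomorphic p 𝒪 L L :=
  ⟨RingEquiv.refl L, RingEquiv.refl K, fun _ => rfl, fun _ => rfl⟩

theorem IsKIsomorphic.symm {L₁ L₂ : IntermediateField K Ks} (h : IsKIsomorphic p 𝒪 L₁ L₂) :
    IsKIsomorphic p 𝒪 L₂ L₁ := by
  obtain ⟨σ, φ, h, hφ⟩ := h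
  refine ⟨σ.symm, φ.symm, fun x => ?_, fun a => ?_⟩
  · rw [RingEquiv.symm_apply_eq, h, RingEquiv.apply_symm_apply]
  · rw [RingEquiv.symm_apply_eq, hφ]

theorem IsKIsomorphic.trans {L₁ L₂ L₃ : IntermediateField K Ks} (h : IsKIsomorphic p 𝒪 L₁ L₂)
    (h' : IsKIsomorphic p 𝒪 L₂ L₃) : IsKIsomorphic p 𝒪 L₁ L₃ := by
  obtain ⟨σ, φ, h, hφ⟩ := h
  obtain ⟨σ', φ', h', hφ'⟩ := h'
  refine ⟨σ.trans σ', φ.trans φ', fun x => ?_, fun a => ?_⟩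
  · rw [RingEquiv.trans_apply, h, h', RingEquiv.trans_apply]
  · rw [RingEquiv.trans_apply, hφ, hφ']

variable (Ks) [IsDiscreteValuationRing 𝒪]

/-- `k`-isomorphism as an equivalence relation on the extensions of degree `p` with break `b`. -/
def kIsoSetoid (b : ℚ) : Setoid (extensionsWithBreak Ks 𝒪 p b) where
  r L₁ L₂ := IsKIsomorphic p 𝒪 L₁.1 L₂.1
  iseqv := ⟨fun L => .refl p 𝒪 L.1, fun h => h.symm, fun h h' => h.trans p 𝒪 h'⟩

/-- The set of `k`-isomorphism classes of totally ramified subextensions of `Ks/K` of degree `p`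
with ramification break `b`. -/
abbrev KIsoClasses (b : ℚ) : Type _ := Quotient (kIsoSetoid Ks p 𝒪 b)

end Isomorphism

end

end LocalFieldExt

/-
Put `n = (p - 1) b`. A root `ρ` of `X^p - w t^m X^l - t` is a prime element of `K(ρ)`. Comparing
leading terms in `ρ^p = w t^m ρ^l + t` for `ρ` and a conjugate `g ρ ≠ ρ` shows that
`(g ρ / ρ - 1)^(p - 1)` has leading term `l w ρ^n`, so the break is `b`. This leading term, divided
by that of the `n`-th power of the prime element, changes by an `n`-th power in `k^×` when `ρ` is
replaced by another prime element of `K(ρ)`; hence the class of `w` modulo `n`-th powers is an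
invariant of the extension.

Conversely, if `L/K` has break `b`, then the minimal equation of a prime element of `L` has its
dominant middle term in degree `l`, so a prime element of `L` is an approximate root of such a
trinomial. Changing both `t` and the prime element improves the approximation until Krasner's
lemma provides an exact root in `L`. The prime element `t` of `K` is immaterial up to
`k`-isomorphism, because automorphisms of `K` that fix `k` act transitively on the prime elements.

Finally, `K(ρ)/K` is Galois exactly when it contains a second conjugate of `ρ`, that is, when the
equation for the leading term of `g ρ / ρ - 1` has a solution in `K(ρ)`: `b` must be an integer
and `l w` a `(p - 1)`-th power.
-/

namespace LocalFieldExt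

section AddValuation

variable {F Γ : Type*} [Field F] [LinearOrderedAddCommGroupWithTop Γ]

/-- `x` and `y` are nonzero and agree to leading order with respect to `v`, that is,
`x / y` is congruent to `1` modulo the maximal ideal; only `v y < v (x - y)` has to be required. -/
def SameLeadingTerm (v : AddValuation F Γ) (x y : F) : Prop := v y < v (x - y)

variable {v : AddValuation F Γ}

theorem map_lt_map_mul_left_iff {c x y : F} (hc : c ≠ 0) : v (c * x) < v (c * y) ↔ v x < v y := by
  rw [v.map_mul, v.map_mul, add_lt_add_iff_right_of_ne_top (v.ne_top_iff.mpr hc)]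

theorem pos_of_map_pow_pos {x : F} {n : ℕ} (h : 0 < v (x ^ n)) : 0 < v x := by
  by_contra! hx
  exact h.not_ge (v.map_pow x n ▸ nsmul_nonpos hx n)

theorem map_natCast_nonneg (n : ℕ) : 0 ≤ v (n : F) := by
  induction n with
  | zero => simp
  | succ n ih => exact Nat.cast_succ (R := F) n ▸ v.map_le_add ih v.map_one.ge

theorem map_natCast_eq_zero (p : ℕ) [Fact p.Prime] [CharP F p] {i : ℕ} (hi : ¬p ∣ i) :
    v (i : F) = 0 := by
  have hp : p.Prime := Fact.out
  obtain ⟨j, -, hj⟩ :=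
    Nat.exists_mul_mod_eq_one_of_coprime (hp.coprime_iff_not_dvd.mpr hi).symm hp.one_lt
  have hij : (i : F) * j = 1 := by
    rw [← Nat.cast_mul, ← Nat.cast_one, CharP.natCast_eq_natCast F p, Nat.ModEq, hj,
      Nat.mod_eq_of_lt hp.one_lt]
  have hsum : v (i : F) + v (j : F) = 0 := by rw [← v.map_mul, hij, v.map_one]
  exact ((add_eq_zero_iff_of_nonneg (map_natCast_nonneg i) (map_natCast_nonneg j)).mp hsum).1

namespace SameLeadingTerm

variable {x y z x' y' : F}

theorem ne_zero_right (h : SameLeadingTerm v x y) : y ≠ 0 := by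
  rintro rfl
  simp [SameLeadingTerm] at h

theorem map_eq (h : SameLeadingTerm v x y) : v x = v y := v.map_eq_of_lt_sub h

theorem ne_zero_left (h : SameLeadingTerm v x y) : x ≠ 0 :=
  v.ne_top_iff.mp (h.map_eq ▸ v.ne_top_iff.mpr h.ne_zero_right)

theorem refl (hx : x ≠ 0) : SameLeadingTerm v x x := by
  simpa [SameLeadingTerm, lt_top_iff_ne_top] using hx

theorem symm (h : SameLeadingTerm v x y) : SameLeadingTerm v y x := by
  rw [SameLeadingTerm, v.map_sub_swap, h.map_eq]
  exact h

theorem trans (h : SameLeadingTerm v x y) (h' : SameLeadingTerm v y z) :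
    SameLeadingTerm v x z := by
  rw [SameLeadingTerm, ← sub_add_sub_cancel x y z]
  exact v.map_lt_add (h'.map_eq ▸ h) h'

theorem mul_left {c : F} (hc : c ≠ 0) (h : SameLeadingTerm v x y) :
    SameLeadingTerm v (c * x) (c * y) := by
  rw [SameLeadingTerm, ← mul_sub]
  exact (map_lt_map_mul_left_iff hc).mpr h

theorem of_mul_left {c : F} (hc : c ≠ 0) (h : SameLeadingTerm v (c * x) (c * y)) :
    SameLeadingTerm v x y := by
  rw [SameLeadingTerm, ← mul_sub] at h
  exact (map_lt_map_mul_left_iff hc).mp h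

theorem mul (h : SameLeadingTerm v x y) (h' : SameLeadingTerm v x' y') :
    SameLeadingTerm v (x * x') (y * y') := by
  refine (h'.mul_left h.ne_zero_left).trans ?_
  simpa only [mul_comm y'] using h.mul_left h'.ne_zero_right

theorem inv (h : SameLeadingTerm v x y) : SameLeadingTerm v x⁻¹ y⁻¹ := by
  have hx := h.ne_zero_left
  have hy := h.ne_zero_right
  convert (h.mul_left (mul_ne_zero (inv_ne_zero hx) (inv_ne_zero hy))).symm using 1 <;>
    field_simp

theorem div (h : SameLeadingTerm v x y) (h' : SameLeadingTerm v x' y') :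
    SameLeadingTerm v (x / x') (y / y') := by
  simpa only [div_eq_mul_inv] using h.mul h'.inv

theorem pow (h : SameLeadingTerm v x y) (n : ℕ) : SameLeadingTerm v (x ^ n) (y ^ n) := by
  induction n with
  | zero => simpa only [pow_zero] using refl one_ne_zero
  | succ n ih => simpa only [pow_succ] using ih.mul h

theorem one_iff : SameLeadingTerm v x 1 ↔ 0 < v (x - 1) := by
  rw [SameLeadingTerm, v.map_one]

end SameLeadingTerm

variable {ε x y : F}

theorem map_one_add (hε : 0 < v ε) : v (1 + ε) = 0 :=
  (SameLeadingTerm.one_iff.mpr (by simpa using hε)).map_eq.trans v.map_one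

theorem le_map_one_add_pow_sub_one (hε : 0 ≤ v ε) (i : ℕ) : v ε ≤ v ((1 + ε) ^ i - 1) := by
  have hone : 0 ≤ v (1 + ε) := v.map_le_add v.map_one.ge hε
  rw [← geom_sum_mul, add_sub_cancel_left, v.map_mul]
  exact le_add_of_nonneg_left
    (v.map_le_sum fun j _ => v.map_pow (1 + ε) j ▸ nsmul_nonneg hone j)

theorem two_nsmul_le_map_one_add_pow_sub (hε : 0 ≤ v ε) (i : ℕ) :
    2 • v ε ≤ v ((1 + ε) ^ i - 1 - i * ε) := by
  have hexpand : (1 + ε) ^ i - 1 - i * ε = (∑ j ∈ Finset.range i, ((1 + ε) ^ j - 1)) * ε := by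
    rw [← geom_sum_mul, Finset.sum_sub_distrib, Finset.sum_const, Finset.card_range,
      nsmul_one]
    ring
  rw [hexpand, v.map_mul, two_nsmul]
  gcongr
  exact v.map_le_sum fun j _ => le_map_one_add_pow_sub_one hε j

theorem sameLeadingTerm_sum_mul_one_add_pow_sub_one {s : Finset ℕ} {c : ℕ → F} {l : ℕ}
    (hl : l ∈ s) (hl0 : v (l : F) = 0) (hε0 : ε ≠ 0) (hε : 0 < v ε) (hc : c l ≠ 0)
    (hdom : ∀ i ∈ s, i ≠ 0 → i ≠ l → v (c l) < v (c i)) :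
    SameLeadingTerm v (∑ i ∈ s, c i * ((1 + ε) ^ i - 1)) (l * (c l * ε)) := by
  have hsplit : ∑ i ∈ s, c i * ((1 + ε) ^ i - 1) - l * (c l * ε) =
      c l * ((1 + ε) ^ l - 1 - l * ε) + ∑ i ∈ s.erase l, c i * ((1 + ε) ^ i - 1) := by
    rw [← Finset.add_sum_erase s _ hl]
    ring
  have hεtop := v.ne_top_iff.mpr hε0
  rw [SameLeadingTerm, hsplit, v.map_mul, hl0, zero_add]
  refine v.map_lt_add ((map_lt_map_mul_left_iff hc).mpr ?_)
    (v.map_lt_sum (v.ne_top_iff.mpr (mul_ne_zero hc hε0)) fun i hi => ?_)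
  · calc v ε < 2 • v ε := by
          simpa only [two_nsmul, zero_add] using (add_lt_add_iff_left_of_ne_top hεtop).mpr hε
      _ ≤ _ := two_nsmul_le_map_one_add_pow_sub hε.le l
  · obtain ⟨hil, his⟩ := Finset.mem_erase.mp hi
    rcases eq_or_ne i 0 with rfl | hi0
    · simpa [lt_top_iff_ne_top] using ⟨hc, hε0⟩
    · calc v (c l * ε) = v (c l) + v ε := v.map_mul _ _
        _ < v (c i) + v ε := (add_lt_add_iff_left_of_ne_top hεtop).mpr (hdom i his hi0 hil)
        _ ≤ v (c i * ((1 + ε) ^ i - 1)) := by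
          rw [v.map_mul]
          gcongr
          exact le_map_one_add_pow_sub_one hε.le i

theorem map_sum_le_of_injOn {ι : Type*} {s : Finset ι} {f : ι → F}
    (h : ∀ i ∈ s, ∀ j ∈ s, f i ≠ 0 → v (f i) = v (f j) → i = j) {i : ι} (hi : i ∈ s) :
    v (∑ j ∈ s, f j) ≤ v (f i) := by
  classical
  obtain ⟨j, hj, hmin⟩ := s.exists_min_image (fun i => v (f i)) ⟨i, hi⟩
  refine le_trans ?_ (hmin i hi)
  by_cases hfj : f j = 0
  · exact hfj ▸ v.map_zero.symm ▸ le_top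
  rw [← Finset.add_sum_erase _ _ hj, v.map_add_eq_of_lt_left]
  refine v.map_lt_sum (v.ne_top_iff.mpr hfj) fun k hk => ?_
  obtain ⟨hkj, hks⟩ := Finset.mem_erase.mp hk
  exact (hmin k hks).lt_of_ne fun he => hkj (h j hj k hks hfj he).symm

theorem sameLeadingTerm_sum {ι : Type*} {s : Finset ι} {f : ι → F} {i : ι} (hi : i ∈ s)
    (h0 : ∑ j ∈ s, f j ≠ 0) (h : ∀ j ∈ s, j ≠ i → v (∑ j ∈ s, f j) < v (f j)) :
    SameLeadingTerm v (f i) (∑ j ∈ s, f j) := by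
  classical
  rw [SameLeadingTerm, v.map_sub_swap]
  nth_rw 2 [← Finset.add_sum_erase s f hi]
  rw [add_sub_cancel_left]
  refine v.map_lt_sum (v.ne_top_iff.mpr h0) fun j hj => ?_
  exact h j (Finset.mem_of_mem_erase hj) (Finset.ne_of_mem_erase hj)

theorem map_lt_map_sum_range_sub {f : ℕ → F} {i k : ℕ} (hk : 0 < k)
    (hi : i ∈ (Finset.range k).erase 0) (h0 : v (f i) ≠ ⊤)
    (h : ∀ j ∈ (Finset.range k).erase 0, j ≠ i → v (f i) < v (f j)) :
    v (f i) < v (∑ j ∈ Finset.range k, f j - (f i + f 0)) := by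
  have hrest : ∑ j ∈ Finset.range k, f j - (f i + f 0) =
      ∑ j ∈ ((Finset.range k).erase 0).erase i, f j := by
    rw [← Finset.add_sum_erase _ _ (Finset.mem_range.mpr hk), ← Finset.add_sum_erase _ _ hi]
    ring
  rw [hrest]
  exact v.map_lt_sum h0 fun j hj => h j (Finset.mem_of_mem_erase hj) (Finset.ne_of_mem_erase hj)

theorem exists_lt_map_sub {S : Multiset F} {B : Γ}
    (h : Multiset.card S • B < v (S.map fun a => y - a).prod) : ∃ a ∈ S, B < v (y - a) := by
  by_contra! hle
  refine h.not_ge ?_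
  clear h
  induction S using Multiset.induction with
  | empty => simp
  | cons a S ih =>
    rw [Multiset.map_cons, Multiset.prod_cons, v.map_mul, Multiset.card_cons, add_comm, succ_nsmul]
    exact add_le_add (ih fun b hb => hle b (Multiset.mem_cons_of_mem hb))
      (hle a (Multiset.mem_cons_self a S))

-- Krasner's lemma, for infinite Galois extensions.
theorem mem_of_forall_map_conj_sub_lt {k : Type*} [Field k] [Algebra k F] [IsGalois k F]
    {L : IntermediateField k F} (hv : ∀ (g : F ≃ₐ[k] F) (a : F), v (g a) = v a) (hy : y ∈ L)
    (h : ∀ g : F ≃ₐ[k] F, g x ≠ x → v (g x - x) < v (x - y)) : x ∈ L := by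
  rw [← InfiniteGalois.fixedField_fixingSubgroup L]
  rintro ⟨g, hg⟩
  change g x = x
  by_contra hgx
  have hgy : g y = y := (IntermediateField.mem_fixingSubgroup_iff _ _).mp hg y hy
  have hsub : g x - x = g (x - y) - (x - y) := by rw [map_sub, hgy]; ring
  refine (h g hgx).not_ge ?_
  rw [hsub]
  exact v.map_le_sub (hv g _).ge le_rfl

end AddValuation

section Base

variable {K : Type*} [Field K] (𝒪 : ValuationSubring K) [IsDiscreteValuationRing 𝒪]

theorem maximalIdeal_valuation_ne_zero {x : K} (hx : x ≠ 0) :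
    (IsDiscreteValuationRing.maximalIdeal 𝒪).valuation K x ≠ 0 :=
  (Valuation.ne_zero_iff _).mpr hx

theorem ordBase_mul {x y : K} (hx : x ≠ 0) (hy : y ≠ 0) :
    ordBase 𝒪 (x * y) = ordBase 𝒪 x + ordBase 𝒪 y := by
  simp only [ordBase, map_mul, WithZero.log_mul (maximalIdeal_valuation_ne_zero 𝒪 hx)
    (maximalIdeal_valuation_ne_zero 𝒪 hy), neg_add]

theorem ordBase_pow {x : K} (hx : x ≠ 0) (n : ℕ) : ordBase 𝒪 (x ^ n) = n * ordBase 𝒪 x := by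
  induction n with
  | zero => simp [ordBase]
  | succ n ih =>
    rw [pow_succ, ordBase_mul 𝒪 (pow_ne_zero n hx) hx, ih]
    push_cast
    ring

theorem ordBase_neg (x : K) : ordBase 𝒪 (-x) = ordBase 𝒪 x := by
  rw [ordBase, Valuation.map_neg, ordBase]

theorem ordBase_nonneg_iff {x : K} (hx : x ≠ 0) : 0 ≤ ordBase 𝒪 x ↔ x ∈ 𝒪 := by
  rw [ordBase, le_neg, neg_zero, ← WithZero.log_one,
    WithZero.log_le_log (maximalIdeal_valuation_ne_zero 𝒪 hx) one_ne_zero]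
  refine ⟨fun h => ?_, fun h =>
    (IsDiscreteValuationRing.maximalIdeal 𝒪).valuation_le_one (K := K) ⟨x, h⟩⟩
  obtain ⟨y, rfl⟩ := IsDiscreteValuationRing.exists_lift_of_le_one h
  exact y.2

theorem le_ordBase_iff_mem_maximalIdeal_pow {x : 𝒪} (hx : x ≠ 0) (n : ℕ) :
    (n : ℤ) ≤ ordBase 𝒪 (x : K) ↔ x ∈ maximalIdeal 𝒪 ^ n := by
  have hval := maximalIdeal_valuation_ne_zero 𝒪 (show (x : K) ≠ 0 by simpa using hx)
  rw [show maximalIdeal 𝒪 = (IsDiscreteValuationRing.maximalIdeal 𝒪).asIdeal from rfl,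
    ← IsDedekindDomain.HeightOneSpectrum.intValuation_le_pow_iff_mem,
    ← IsDedekindDomain.HeightOneSpectrum.valuation_of_algebraMap (K := K), ordBase, le_neg,
    ← WithZero.log_exp (-(n : ℤ)), WithZero.log_le_log hval (by simp)]
  rfl

theorem ordBase_pos_iff {x : 𝒪} (hx : x ≠ 0) : 0 < ordBase 𝒪 (x : K) ↔ x ∈ maximalIdeal 𝒪 := by
  rw [← pow_one (maximalIdeal 𝒪), ← le_ordBase_iff_mem_maximalIdeal_pow 𝒪 hx]
  rfl

theorem ordBase_eq_zero_iff {x : 𝒪} (hx : x ≠ 0) : ordBase 𝒪 (x : K) = 0 ↔ IsUnit x := by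
  rw [← notMem_maximalIdeal, ← ordBase_pos_iff 𝒪 hx, not_lt]
  exact ⟨le_of_eq, fun h => h.antisymm ((ordBase_nonneg_iff 𝒪 (by simpa using hx)).mpr x.2)⟩

theorem ordBase_eq_one_of_irreducible {x : 𝒪} (hx : Irreducible x) : ordBase 𝒪 (x : K) = 1 := by
  change -WithZero.log ((IsDiscreteValuationRing.maximalIdeal 𝒪).valuation K
    (algebraMap 𝒪 K x)) = 1
  rw [IsDedekindDomain.HeightOneSpectrum.valuation_of_algebraMap,
    IsDedekindDomain.HeightOneSpectrum.intValuation_singleton _ hx.ne_zero hx.maximalIdeal_eq,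
    WithZero.log_exp, neg_neg]

theorem ordBase_eq_one_iff {x : 𝒪} : ordBase 𝒪 (x : K) = 1 ↔ Irreducible x := by
  refine ⟨fun h => ?_, ordBase_eq_one_of_irreducible 𝒪⟩
  obtain ⟨t, ht⟩ := IsDiscreteValuationRing.exists_irreducible 𝒪
  have hx : x ≠ 0 := by
    rintro rfl
    simp [ordBase] at h
  have hmem := (ordBase_pos_iff 𝒪 hx).mp (h ▸ one_pos)
  rw [ht.maximalIdeal_eq, Ideal.mem_span_singleton] at hmem
  obtain ⟨u, rfl⟩ := hmem
  have hu : u ≠ 0 := right_ne_zero_of_mul hx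
  push_cast at h
  rw [ordBase_mul 𝒪 (by simpa using ht.ne_zero) (by simpa using hu),
    ordBase_eq_one_of_irreducible 𝒪 ht, add_eq_left, ordBase_eq_zero_iff 𝒪 hu] at h
  exact (associated_mul_unit_right t u h).irreducible ht

end Base

section Complete

variable {K : Type*} [Field K] (𝒪 : ValuationSubring K) [IsDiscreteValuationRing 𝒪]

open scoped NNReal in
/-- The absolute value `2 ^ (-ordBase x)` of `K`, which gives access to the spectral norm of its
algebraic extensions. -/
noncomputable abbrev baseAbv : AbsoluteValue K ℝ :=
  (IsDiscreteValuationRing.maximalIdeal 𝒪).adicAbv (K := K) (one_lt_two : (1 : ℝ≥0) < 2)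

open scoped NNReal in
theorem baseAbv_eq {x : K} (hx : x ≠ 0) : baseAbv 𝒪 x = (2 : ℝ) ^ (-ordBase 𝒪 x) := by
  have hval := maximalIdeal_valuation_ne_zero 𝒪 hx
  change ((WithZeroMulInt.toNNReal (two_ne_zero : (2 : ℝ≥0) ≠ 0) _ : ℝ≥0) : ℝ) = _
  rw [WithZeroMulInt.toNNReal_neg_apply two_ne_zero hval, ordBase, neg_neg, NNReal.coe_zpow]
  congr 1
  generalize (IsDiscreteValuationRing.maximalIdeal 𝒪).valuation K x = z at hval
  lift z to Multiplicative ℤ using hval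
  rfl

theorem baseAbv_le_iff {x : K} {n : ℕ} :
    baseAbv 𝒪 x ≤ (2 : ℝ) ^ (-(n : ℤ)) ↔ ∃ y ∈ maximalIdeal 𝒪 ^ n, (y : K) = x := by
  rcases eq_or_ne x 0 with rfl | hx
  · exact iff_of_true (by simp) ⟨0, zero_mem _, rfl⟩
  rw [baseAbv_eq 𝒪 hx, zpow_le_zpow_iff_right₀ one_lt_two, neg_le_neg_iff]
  constructor
  · intro h
    have hx𝒪 := (ordBase_nonneg_iff 𝒪 hx).mp (by omega)
    exact ⟨⟨x, hx𝒪⟩, (le_ordBase_iff_mem_maximalIdeal_pow 𝒪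
      (by simpa [Subtype.ext_iff] using hx) n).mp h, rfl⟩
  · rintro ⟨y, hy, rfl⟩
    exact (le_ordBase_iff_mem_maximalIdeal_pow 𝒪 (by simpa using hx) n).mpr hy

/-- The absolute value `baseAbv` as a structure of nontrivially normed field. -/
noncomputable abbrev baseNormedField : NontriviallyNormedField K :=
  { (baseAbv 𝒪).toNormedField with
    non_trivial := by
      obtain ⟨t, ht⟩ := IsDiscreteValuationRing.exists_irreducible 𝒪
      refine ⟨(t : K)⁻¹, ?_⟩
      change 1 < baseAbv 𝒪 (t : K)⁻¹
      rw [map_inv₀, baseAbv_eq 𝒪 (by simpa using ht.ne_zero), ordBase_eq_one_of_irreducible 𝒪 ht]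
      norm_num }

variable [IsAdicComplete (maximalIdeal 𝒪) 𝒪]

theorem exists_forall_baseAbv_sub_le {u : ℕ → K}
    (hu : ∀ N n, N ≤ n → baseAbv 𝒪 (u N - u n) ≤ (2 : ℝ) ^ (-(N : ℤ))) :
    ∃ x : K, ∀ N, baseAbv 𝒪 (u N - x) ≤ (2 : ℝ) ^ (-(N : ℤ)) := by
  simp only [baseAbv_le_iff] at hu ⊢
  choose g _ hgu using fun n => hu 0 n n.zero_le
  obtain ⟨y, hy⟩ := IsPrecomplete.prec (I := maximalIdeal 𝒪) (M := 𝒪) inferInstance (f := g)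
    fun {N n} hNn => by
      obtain ⟨z, hz, hzu⟩ := hu N n hNn
      rw [smul_eq_mul, Ideal.mul_top, SModEq.sub_mem]
      convert neg_mem hz using 1
      exact Subtype.ext (by push_cast; rw [hgu, hgu, hzu]; ring)
  refine ⟨u 0 - y, fun N => ⟨-(g N - y), neg_mem ?_, ?_⟩⟩
  · simpa only [smul_eq_mul, Ideal.mul_top, SModEq.sub_mem] using hy N
  · push_cast
    rw [hgu]
    ring

theorem completeSpace_baseAbv :
    letI := (baseAbv 𝒪).toNormedField
    CompleteSpace K := by
  let := (baseAbv 𝒪).toNormedField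
  refine Metric.complete_of_convergent_controlled_sequences (fun N : ℕ => (2 : ℝ) ^ (-(N : ℤ)))
    (fun N => by positivity) fun u hu => ?_
  obtain ⟨x, hx⟩ := exists_forall_baseAbv_sub_le 𝒪 fun N n hNn =>
    (dist_eq_norm (u N) (u n)).symm.trans_le (hu N N n le_rfl hNn).le
  refine ⟨x, tendsto_iff_norm_sub_tendsto_zero.mpr (squeeze_zero (fun _ => norm_nonneg _) hx ?_)⟩
  simp only [zpow_neg, zpow_natCast, ← inv_pow]
  exact tendsto_pow_atTop_nhds_zero_of_lt_one (by norm_num) (by norm_num)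

end Complete

section Ord

variable {K Ks : Type*} [Field K] [Field Ks] [Algebra K Ks] (𝒪 : ValuationSubring K)
  [IsDiscreteValuationRing 𝒪]

theorem ord_zero : ord 𝒪 (0 : Ks) = ⊤ := if_pos rfl

variable [Algebra.IsAlgebraic K Ks]

theorem ord_eq_minpoly {x : Ks} (hx : x ≠ 0) : ord 𝒪 x =
    ((ordBase 𝒪 ((minpoly K x).coeff 0) / (minpoly K x).natDegree : ℚ) : WithTop ℚ) := by
  have hint : IsIntegral K x := Algebra.IsIntegral.isIntegral x
  have hnorm : ordBase 𝒪 (Algebra.norm K (IntermediateField.AdjoinSimple.gen K x)) =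
      ordBase 𝒪 ((minpoly K x).coeff 0) := by
    have := Algebra.PowerBasis.norm_gen_eq_coeff_zero_minpoly
      (IntermediateField.adjoin.powerBasis hint)
    rw [IntermediateField.adjoin.powerBasis_gen, IntermediateField.minpoly_gen] at this
    rw [this]
    rcases neg_one_pow_eq_or K (IntermediateField.adjoin.powerBasis hint).dim with h | h <;>
      simp only [h, one_mul, neg_one_mul, ordBase_neg]
  rw [ord, if_neg hx, IntermediateField.adjoin.finrank hint, hnorm]

theorem ord_eq_of_minpoly_eq {x y : Ks} (h : minpoly K x = minpoly K y) : ord 𝒪 x = ord 𝒪 y := by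
  have hzero : x = 0 ↔ y = 0 := by
    rw [← minpoly.coeff_zero_eq_zero (A := K) (Algebra.IsIntegral.isIntegral x), h,
      minpoly.coeff_zero_eq_zero (Algebra.IsIntegral.isIntegral y)]
  rcases eq_or_ne x 0 with hx | hx
  · rw [hx, hzero.mp hx]
  · rw [ord_eq_minpoly 𝒪 hx, ord_eq_minpoly 𝒪 (hzero.not.mp hx), h]

theorem ord_algebraMap {x : K} (hx : x ≠ 0) :
    ord 𝒪 (algebraMap K Ks x) = ((ordBase 𝒪 x : ℚ) : WithTop ℚ) := by
  have hmin : minpoly K (algebraMap K Ks x) = X - C x := minpoly.eq_X_sub_C _ x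
  rw [ord_eq_minpoly 𝒪 (by simpa using hx), hmin]
  simp [ordBase_neg]

variable [IsAdicComplete (maximalIdeal 𝒪) 𝒪]

theorem exists_spectralNorm_eq_two_rpow_neg_ord :
    ∃ f : Ks → ℝ, (∀ x y, f (x * y) = f x * f y) ∧ (∀ x y, f (x + y) ≤ max (f x) (f y)) ∧
      ∀ x, x ≠ 0 → ∃ q : ℚ, ord 𝒪 x = q ∧ f x = (2 : ℝ) ^ (-(q : ℝ)) := by
  let := baseNormedField 𝒪
  have : IsUltrametricDist K := IsUltrametricDist.isUltrametricDist_of_isNonarchimedean_norm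
    (IsDedekindDomain.HeightOneSpectrum.isNonarchimedean_adicAbv _ _)
  have : CompleteSpace K := completeSpace_baseAbv 𝒪
  refine ⟨spectralNorm K Ks, map_mul (spectralMulAlgNorm K Ks), isNonarchimedean_spectralNorm,
    fun x hx => ⟨_, ord_eq_minpoly 𝒪 hx, ?_⟩⟩
  have hcoeff : (minpoly K x).coeff 0 ≠ 0 :=
    minpoly.coeff_zero_ne_zero (Algebra.IsIntegral.isIntegral x) hx
  rw [spectralNorm.spectralNorm_eq_norm_coeff_zero_rpow,
    show ‖(minpoly K x).coeff 0‖ = _ from baseAbv_eq 𝒪 hcoeff, ← Real.rpow_intCast,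
    ← Real.rpow_mul zero_le_two]
  congr 1
  push_cast
  ring

theorem ord_mul (x y : Ks) : ord 𝒪 (x * y) = ord 𝒪 x + ord 𝒪 y := by
  rcases eq_or_ne x 0 with rfl | hx
  · rw [zero_mul, ord_zero, top_add]
  rcases eq_or_ne y 0 with rfl | hy
  · rw [mul_zero, ord_zero, add_top]
  obtain ⟨f, hmul, -, hf⟩ := exists_spectralNorm_eq_two_rpow_neg_ord 𝒪 (Ks := Ks)
  obtain ⟨a, ha, hfa⟩ := hf x hx
  obtain ⟨b, hb, hfb⟩ := hf y hy
  obtain ⟨c, hc, hfc⟩ := hf (x * y) (mul_ne_zero hx hy)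
  rw [hmul, hfa, hfb, ← Real.rpow_add two_pos, Real.rpow_right_inj two_pos (by norm_num)] at hfc
  rw [ha, hb, hc, ← WithTop.coe_add]
  have habc : (c : ℝ) = a + b := by linarith
  exact_mod_cast habc

theorem min_ord_le_ord_add (x y : Ks) : min (ord 𝒪 x) (ord 𝒪 y) ≤ ord 𝒪 (x + y) := by
  rcases eq_or_ne x 0 with rfl | hx
  · simp
  rcases eq_or_ne y 0 with rfl | hy
  · simp
  rcases eq_or_ne (x + y) 0 with hxy | hxy
  · rw [hxy, ord_zero]
    exact le_top
  obtain ⟨f, -, hadd, hf⟩ := exists_spectralNorm_eq_two_rpow_neg_ord 𝒪 (Ks := Ks)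
  obtain ⟨a, ha, hfa⟩ := hf x hx
  obtain ⟨b, hb, hfb⟩ := hf y hy
  obtain ⟨c, hc, hfc⟩ := hf (x + y) hxy
  have hfxy := hadd x y
  rw [hfa, hfb, hfc, le_max_iff, Real.rpow_le_rpow_left_iff one_lt_two,
    Real.rpow_le_rpow_left_iff one_lt_two, neg_le_neg_iff, neg_le_neg_iff] at hfxy
  rw [ha, hb, hc, min_le_iff, WithTop.coe_le_coe, WithTop.coe_le_coe]
  exact_mod_cast hfxy

end Ord

section ScaledOrd

variable {K : Type*} [Field K] (𝒪 : ValuationSubring K) [IsDiscreteValuationRing 𝒪]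
  [IsAdicComplete (maximalIdeal 𝒪) 𝒪] (Ks : Type*) [Field Ks] [Algebra K Ks]
  [Algebra.IsAlgebraic K Ks] (e : ℕ) [NeZero e]

/-- The valuation `e • ord` of `Ks`, under which prime elements of `K` have the value `e`. It is
`ordOf 𝒪 L` for the subextensions `L` of degree `e`, and does not depend on `L`. -/
noncomputable def scaledOrd : AddValuation Ks (WithTop ℚ) :=
  AddValuation.of (fun x => e • ord 𝒪 x)
    (by rw [← Nat.succ_pred (NeZero.ne e), succ_nsmul, ord_zero, add_top])
    (by simpa [ordBase] using congrArg (e • ·) (ord_algebraMap 𝒪 (Ks := Ks) one_ne_zero))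
    (fun x y => (nsmul_right_mono e).map_min.symm.trans_le
      (nsmul_le_nsmul_right (min_ord_le_ord_add 𝒪 x y) e))
    (fun x y => by rw [ord_mul, nsmul_add])

variable {Ks}

local notation "ν" => scaledOrd 𝒪 Ks e

theorem scaledOrd_apply (x : Ks) : ν x = e • ord 𝒪 x := rfl

theorem scaledOrd_of_minpoly_eq {x y : Ks} (h : minpoly K x = minpoly K y) : ν x = ν y :=
  congrArg (e • ·) (ord_eq_of_minpoly_eq 𝒪 h)

theorem scaledOrd_algEquiv (g : Ks ≃ₐ[K] Ks) (x : Ks) : ν (g x) = ν x :=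
  scaledOrd_of_minpoly_eq 𝒪 e (minpoly.algEquiv_eq g x)

theorem scaledOrd_eq_coe_iff {x : Ks} {r : ℚ} :
    ν x = ((e * r : ℚ) : WithTop ℚ) ↔ ord 𝒪 x = (r : WithTop ℚ) := by
  rcases eq_or_ne x 0 with rfl | hx
  · rw [AddValuation.map_zero, ord_zero]
    exact iff_of_false WithTop.top_ne_coe WithTop.top_ne_coe
  · rw [scaledOrd_apply, ord_eq_minpoly 𝒪 hx, ← WithTop.coe_nsmul, WithTop.coe_inj, WithTop.coe_inj,
      nsmul_eq_mul, mul_right_inj' (Nat.cast_ne_zero.mpr (NeZero.ne e))]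

theorem scaledOrd_algebraMap {a : K} (ha : a ≠ 0) :
    ν (algebraMap K Ks a) = ((e * ordBase 𝒪 a : ℚ) : WithTop ℚ) :=
  (scaledOrd_eq_coe_iff 𝒪 e).mpr (ord_algebraMap 𝒪 ha)

theorem scaledOrd_algebraMap_nonneg_iff {a : K} : 0 ≤ ν (algebraMap K Ks a) ↔ a ∈ 𝒪 := by
  rcases eq_or_ne a 0 with rfl | ha
  · simp
  rw [scaledOrd_algebraMap 𝒪 e ha, ← WithTop.coe_zero, WithTop.coe_le_coe,
    mul_nonneg_iff_of_pos_left (Nat.cast_pos.mpr (NeZero.pos e)), ← ordBase_nonneg_iff 𝒪 ha]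
  exact Int.cast_nonneg_iff

theorem scaledOrd_algebraMap_pos_iff {a : 𝒪} :
    0 < ν (algebraMap K Ks a) ↔ a ∈ maximalIdeal 𝒪 := by
  rcases eq_or_ne a 0 with rfl | ha
  · simp
  rw [scaledOrd_algebraMap 𝒪 e (by simpa using ha), ← WithTop.coe_zero, WithTop.coe_lt_coe,
    mul_pos_iff_of_pos_left (Nat.cast_pos.mpr (NeZero.pos e)), ← ordBase_pos_iff 𝒪 ha]
  exact Int.cast_pos

theorem scaledOrd_algebraMap_eq_zero_iff {a : 𝒪} (ha : a ≠ 0) :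
    ν (algebraMap K Ks a) = 0 ↔ IsUnit a := by
  rw [scaledOrd_algebraMap 𝒪 e (by simpa using ha), ← WithTop.coe_zero, WithTop.coe_inj,
    mul_eq_zero_iff_left (Nat.cast_ne_zero.mpr (NeZero.ne e)), ← ordBase_eq_zero_iff 𝒪 ha]
  exact Int.cast_eq_zero

theorem scaledOrd_algebraMap_eq_natCast_iff {a : 𝒪} :
    ν (algebraMap K Ks a) = (e : ℚ) ↔ Irreducible a := by
  rcases eq_or_ne a 0 with rfl | ha
  · simp
  rw [scaledOrd_algebraMap 𝒪 e (by simpa using ha), ← ordBase_eq_one_iff, WithTop.coe_inj,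
    mul_eq_left₀ (Nat.cast_ne_zero.mpr (NeZero.ne e))]
  exact Int.cast_eq_one

end ScaledOrd

section Integrality

variable {K Ks : Type*} [Field K] [Field Ks] [Algebra K Ks] [Algebra.IsAlgebraic K Ks]
  (𝒪 : ValuationSubring K) [IsDiscreteValuationRing 𝒪]

theorem exists_ord_eq_div_finrank {L : IntermediateField K Ks} [FiniteDimensional K L] {x : Ks}
    (hxL : x ∈ L) (hx : x ≠ 0) :
    ∃ z : ℤ, ord 𝒪 x = ((z / Module.finrank K L : ℚ) : WithTop ℚ) := by
  have hint : IsIntegral K x := Algebra.IsIntegral.isIntegral x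
  obtain ⟨d, hd⟩ := IntermediateField.finrank_dvd_of_le_right
    (IntermediateField.adjoin_simple_le_iff.mpr hxL)
  rw [IntermediateField.adjoin.finrank hint] at hd
  have hd0 : (d : ℚ) ≠ 0 := by
    rintro h
    rw [Nat.cast_eq_zero.mp h, mul_zero] at hd
    exact Module.finrank_pos.ne' hd
  refine ⟨ordBase 𝒪 ((minpoly K x).coeff 0) * d, ?_⟩
  rw [ord_eq_minpoly 𝒪 hx, hd]
  push_cast
  rw [mul_div_mul_right _ _ hd0]

end Integrality

theorem map_pow_of_eq_coe {F : Type*} [Field F] {v : AddValuation F (WithTop ℚ)} {x : F} {r : ℚ}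
    (h : v x = r) (n : ℕ) : v (x ^ n) = ((n * r : ℚ) : WithTop ℚ) := by
  rw [v.map_pow, h, ← WithTop.coe_nsmul, nsmul_eq_mul]

theorem map_zpow_of_eq_one {F : Type*} [Field F] {v : AddValuation F (WithTop ℚ)} {x : F}
    (h : v x = 1) (z : ℤ) : v (x ^ z) = ((z : ℚ) : WithTop ℚ) := by
  have hnat (n : ℕ) : v (x ^ n) = ((n : ℚ) : WithTop ℚ) := by simp [h]
  obtain ⟨n, rfl | rfl⟩ := z.eq_nat_or_neg
  · rw [zpow_natCast, hnat, Int.cast_natCast]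
  · rw [zpow_neg, zpow_natCast, v.map_inv, hnat, Int.cast_neg, Int.cast_natCast]
    rfl

section PrimeElement

variable {K Ks : Type*} [Field K] [Field Ks] [Algebra K Ks] [Algebra.IsAlgebraic K Ks]
  (𝒪 : ValuationSubring K) [IsDiscreteValuationRing 𝒪] [IsAdicComplete (maximalIdeal 𝒪) 𝒪]
  (e : ℕ) [NeZero e]

local notation "ν" => scaledOrd 𝒪 Ks e

/-- `L/K` has degree `e` and `π` is a prime element of `L`. The existence of `π` implies that
`L/K` is totally ramified, see `IsPrimeElement.isTotallyRamified`. -/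
structure IsPrimeElement (L : IntermediateField K Ks) (π : Ks) : Prop where
  finrank_eq : Module.finrank K L = e
  mem : π ∈ L
  scaledOrd_eq_one : ν π = 1

theorem ordOf_eq_scaledOrd {L : IntermediateField K Ks} (hL : Module.finrank K L = e) (x : Ks) :
    ordOf 𝒪 L x = ν x := by
  rw [ordOf, hL, scaledOrd_apply]

theorem dvd_finrank_adjoin {x : Ks} (hx : ν x = 1) : e ∣ Module.finrank K K⟮x⟯ := by
  have hint : IsIntegral K x := Algebra.IsIntegral.isIntegral x
  have := IntermediateField.adjoin.finiteDimensional hint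
  have hx0 : x ≠ 0 := by
    rintro rfl
    simp at hx
  obtain ⟨z, hz⟩ := exists_ord_eq_div_finrank 𝒪 (IntermediateField.mem_adjoin_simple_self K x) hx0
  rw [← scaledOrd_eq_coe_iff 𝒪 e, hx, ← WithTop.coe_one, WithTop.coe_inj, ← mul_div_assoc,
    eq_div_iff (Nat.cast_ne_zero.mpr Module.finrank_pos.ne'), one_mul] at hz
  have hdvd : (e : ℤ) ∣ (Module.finrank K K⟮x⟯ : ℤ) := ⟨z, mod_cast hz⟩
  exact_mod_cast hdvd

variable {𝒪 e}

namespace IsPrimeElement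

variable {L : IntermediateField K Ks} {π : Ks} (h : IsPrimeElement 𝒪 e L π)

include h

theorem ne_zero : π ≠ 0 := by
  rintro rfl
  simpa using h.scaledOrd_eq_one

theorem finiteDimensional : FiniteDimensional K L :=
  Module.finite_of_finrank_pos (h.finrank_eq ▸ NeZero.pos e)

theorem adjoin_eq : K⟮π⟯ = L := by
  have := h.finiteDimensional
  have := IntermediateField.adjoin.finiteDimensional (Algebra.IsIntegral.isIntegral (R := K) π)
  refine IntermediateField.eq_of_le_of_finrank_le
    (IntermediateField.adjoin_simple_le_iff.mpr h.mem) ?_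
  rw [h.finrank_eq]
  exact Nat.le_of_dvd Module.finrank_pos (dvd_finrank_adjoin 𝒪 e h.scaledOrd_eq_one)

theorem exists_scaledOrd_eq_intCast {x : Ks} (hxL : x ∈ L) (hx : x ≠ 0) :
    ∃ z : ℤ, ν x = ((z : ℚ) : WithTop ℚ) := by
  have := h.finiteDimensional
  obtain ⟨z, hz⟩ := exists_ord_eq_div_finrank 𝒪 hxL hx
  refine ⟨z, ?_⟩
  rw [(scaledOrd_eq_coe_iff 𝒪 e).mpr hz, h.finrank_eq,
    mul_div_cancel₀ _ (Nat.cast_ne_zero.mpr (NeZero.ne e))]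

theorem isTotallyRamified : IsTotallyRamified 𝒪 L := by
  have := h.finiteDimensional
  refine ⟨this, fun r => ⟨?_, ?_⟩⟩
  · rintro ⟨x, hxL, hx⟩
    have hx0 : x ≠ 0 := by
      rintro rfl
      exact WithTop.top_ne_coe ((ord_zero 𝒪).symm.trans hx)
    obtain ⟨z, hz⟩ := exists_ord_eq_div_finrank 𝒪 hxL hx0
    exact ⟨z, WithTop.coe_inj.mp (hx.symm.trans hz)⟩
  · rintro ⟨z, rfl⟩
    refine ⟨π ^ z, zpow_mem h.mem z, ?_⟩
    rw [← scaledOrd_eq_coe_iff 𝒪 e, h.finrank_eq,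
      mul_div_cancel₀ _ (Nat.cast_ne_zero.mpr (NeZero.ne e)),
      map_zpow_of_eq_one h.scaledOrd_eq_one]

theorem scaledOrd_term {a : K} (ha : a ≠ 0) (i : ℕ) :
    ν (algebraMap K Ks a * π ^ i) = ((e * ordBase 𝒪 a + i : ℚ) : WithTop ℚ) := by
  rw [AddValuation.map_mul, scaledOrd_algebraMap 𝒪 e ha,
    map_pow_of_eq_coe (r := 1) h.scaledOrd_eq_one, mul_one, WithTop.coe_add]

theorem eq_of_scaledOrd_term_eq {a b : K} {i j : ℕ} (ha : a ≠ 0) (hi : i < e) (hj : j < e)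
    (hij : ν (algebraMap K Ks a * π ^ i) = ν (algebraMap K Ks b * π ^ j)) : i = j := by
  have hb : b ≠ 0 := by
    rintro rfl
    rw [h.scaledOrd_term ha, map_zero, zero_mul, AddValuation.map_zero] at hij
    exact WithTop.coe_ne_top hij
  rw [h.scaledOrd_term ha, h.scaledOrd_term hb, WithTop.coe_inj] at hij
  have hmod : ((e : ℤ) * ordBase 𝒪 a + i) % e = (e * ordBase 𝒪 b + j) % e :=
    congrArg (· % (e : ℤ)) (mod_cast hij)
  rw [Int.mul_add_emod_self_left, Int.mul_add_emod_self_left] at hmod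
  rw [Int.emod_eq_of_lt (by lia) (by lia), Int.emod_eq_of_lt (by lia) (by lia)] at hmod
  exact_mod_cast hmod

theorem exists_eq_sum {y : Ks} (hy : y ∈ L) :
    ∃ a : ℕ → K, y = ∑ i ∈ Finset.range e, algebraMap K Ks (a i) * π ^ i := by
  have hint : IsIntegral K π := Algebra.IsIntegral.isIntegral π
  rw [← h.adjoin_eq] at hy
  obtain ⟨f, hf, hfy⟩ := (IntermediateField.adjoin.powerBasis hint).exists_eq_aeval
    (⟨y, hy⟩ : K⟮π⟯)
  rw [IntermediateField.adjoin.powerBasis_dim, ← IntermediateField.adjoin.finrank hint,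
    h.adjoin_eq, h.finrank_eq] at hf
  have hsum := congrArg (algebraMap K⟮π⟯ Ks) hfy
  rw [IntermediateField.adjoin.powerBasis_gen, ← Polynomial.aeval_algebraMap_apply,
    IntermediateField.AdjoinSimple.algebraMap_gen, aeval_eq_sum_range' hf] at hsum
  exact ⟨f.coeff, by simpa only [Algebra.smul_def, IntermediateField.algebraMap_apply] using hsum⟩

theorem scaledOrd_sum_le (a : ℕ → K) {i : ℕ} (hi : i < e) :
    ν (∑ j ∈ Finset.range e, algebraMap K Ks (a j) * π ^ j) ≤ ν (algebraMap K Ks (a i) * π ^ i) :=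
  map_sum_le_of_injOn (f := fun j => algebraMap K Ks (a j) * π ^ j)
    (fun _ hj _ hk hj0 hjk => h.eq_of_scaledOrd_term_eq
      ((_root_.map_ne_zero _).mp (left_ne_zero_of_mul hj0)) (Finset.mem_range.mp hj)
      (Finset.mem_range.mp hk) hjk)
    (Finset.mem_range.mpr hi)

theorem scaledOrd_sum_lt {a : ℕ → K} {b : K} {i j : ℕ} (hb : b ≠ 0) (hi : i < e) (hj : j < e)
    (hij : i ≠ j) (hsum : ν (∑ k ∈ Finset.range e, algebraMap K Ks (a k) * π ^ k) =
      ν (algebraMap K Ks b * π ^ j)) :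
    ν (∑ k ∈ Finset.range e, algebraMap K Ks (a k) * π ^ k) < ν (algebraMap K Ks (a i) * π ^ i) :=
  (h.scaledOrd_sum_le a hi).lt_of_ne fun heq =>
    hij (h.eq_of_scaledOrd_term_eq hb hj hi (hsum.symm.trans heq)).symm

theorem exists_sub_algebraMap_pos {y : Ks} (hy : y ∈ L) (hy0 : 0 ≤ ν y) :
    ∃ c : 𝒪, 0 < ν (y - algebraMap K Ks c) := by
  rcases hy0.lt_or_eq with hpos | hzero
  · exact ⟨0, by simpa using hpos⟩
  obtain ⟨a, rfl⟩ := h.exists_eq_sum hy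
  have hν : ν (∑ k ∈ Finset.range e, algebraMap K Ks (a k) * π ^ k) =
      ν (algebraMap K Ks 1 * π ^ 0) := by
    simpa using hzero.symm
  have ha0 : 0 ≤ ν (algebraMap K Ks (a 0)) := by
    simpa using hy0.trans (h.scaledOrd_sum_le a (NeZero.pos e))
  refine ⟨⟨a 0, (scaledOrd_algebraMap_nonneg_iff 𝒪 e).mp ha0⟩, ?_⟩
  have hlead := sameLeadingTerm_sum (f := fun k => algebraMap K Ks (a k) * π ^ k)
    (Finset.mem_range.mpr (NeZero.pos e)) ((AddValuation.ne_top_iff ν).mp (by simp [← hzero]))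
    fun i hi hi0 => h.scaledOrd_sum_lt one_ne_zero (Finset.mem_range.mp hi) (NeZero.pos e) hi0 hν
  rw [SameLeadingTerm, AddValuation.map_sub_swap, pow_zero, mul_one] at hlead
  exact hy0.trans_lt hlead

-- `ε ↦ y ε` is the leading term of `g y - y` because the term `a₁ π` of `y` dominates.
theorem sameLeadingTerm_conj_div_sub_one (he : 1 < e) {y : Ks} (hy : IsPrimeElement 𝒪 e L y)
    (g : Ks ≃ₐ[K] Ks) (hgπ : g π ≠ π) (hg : 0 < ν (g π / π - 1)) :
    SameLeadingTerm ν (g y / y - 1) (g π / π - 1) := by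
  obtain ⟨a, hya⟩ := h.exists_eq_sum hy.mem
  set c : ℕ → Ks := fun i => algebraMap K Ks (a i) * π ^ i with hc
  set ε := g π / π - 1 with hε
  have hε0 : ε ≠ 0 := by rwa [hε, sub_ne_zero, Ne, div_eq_one_iff_eq h.ne_zero]
  have hνy : ν (∑ i ∈ Finset.range e, c i) = ν (algebraMap K Ks 1 * π ^ 1) := by
    simp [← hya, hy.scaledOrd_eq_one, h.scaledOrd_eq_one]
  have hdom (i : ℕ) (hi : i ∈ Finset.range e) (hi1 : i ≠ 1) : ν (∑ i ∈ Finset.range e, c i) <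
      ν (c i) := h.scaledOrd_sum_lt one_ne_zero (Finset.mem_range.mp hi) he hi1 hνy
  have hlead : SameLeadingTerm ν (c 1) y := by
    rw [hya]
    exact sameLeadingTerm_sum (Finset.mem_range.mpr he) (hya ▸ hy.ne_zero) hdom
  have hgy : g y - y = ∑ i ∈ Finset.range e, c i * ((1 + ε) ^ i - 1) := by
    have hgπε : g π = π * (1 + ε) := by
      rw [hε, add_sub_cancel, mul_div_cancel₀ _ h.ne_zero]
    conv_lhs => rw [hya, map_sum, ← Finset.sum_sub_distrib]
    refine Finset.sum_congr rfl fun i _ => ?_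
    rw [hc, map_mul, map_pow, AlgEquiv.commutes, hgπε, mul_pow]
    ring
  have hgy' := sameLeadingTerm_sum_mul_one_add_pow_sub_one (Finset.mem_range.mpr he) (by simp) hε0
    hg hlead.ne_zero_left fun i hi _ hi1 => by rw [hlead.map_eq, hya]; exact hdom i hi hi1
  rw [← hgy, Nat.cast_one, one_mul] at hgy'
  have hdiv := (hgy'.trans (hlead.mul (.refl hε0))).div (.refl hy.ne_zero)
  rwa [sub_div, div_self hy.ne_zero, mul_div_cancel_left₀ _ hy.ne_zero] at hdiv

theorem exists_algEquiv_ne [IsGalois K Ks] (he : e ≠ 1) : ∃ g : Ks ≃ₐ[K] Ks, g π ≠ π := by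
  by_contra! hfix
  have hbot := IntermediateField.adjoin_simple_eq_bot_iff.mpr
    ((InfiniteGalois.mem_bot_iff_fixed (k := K) π).mpr hfix)
  rw [h.adjoin_eq] at hbot
  exact he (by rw [← h.finrank_eq, hbot, IntermediateField.finrank_bot])

end IsPrimeElement

end PrimeElement

section Polynomial

variable {K : Type*} [Field K] (p : ℕ) (t w : K) (m l : ℕ)

/-- The trinomial `X ^ p - w t ^ m X ^ l - t`, which is `amanoPolynomial` when `w` is the
Teichmüller lift of `ω`. -/
noncomputable def amanoTrinomial : K[X] := X ^ p - C (w * t ^ m) * X ^ l - C t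

variable {p t w m l}

theorem amanoTrinomial_eq_X_pow_sub :
    amanoTrinomial p t w m l = X ^ p - (C (w * t ^ m) * X ^ l + C t) := sub_sub _ _ _

theorem natDegree_amanoTrinomial_tail_lt (hlp : l < p) :
    (C (w * t ^ m) * X ^ l + C t).natDegree < p :=
  lt_of_le_of_lt (by compute_degree) hlp

theorem monic_amanoTrinomial (hlp : l < p) : (amanoTrinomial p t w m l).Monic :=
  amanoTrinomial_eq_X_pow_sub (K := K) ▸ monic_X_pow_sub
    (degree_le_natDegree.trans_lt (Nat.cast_lt.mpr (natDegree_amanoTrinomial_tail_lt hlp)))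

theorem natDegree_amanoTrinomial (hlp : l < p) : (amanoTrinomial p t w m l).natDegree = p := by
  rw [amanoTrinomial_eq_X_pow_sub, natDegree_sub_eq_left_of_natDegree_lt, natDegree_X_pow]
  exact (natDegree_amanoTrinomial_tail_lt hlp).trans_eq (natDegree_X_pow p).symm

theorem aeval_amanoTrinomial {F : Type*} [Field F] [Algebra K F] (x : F) :
    aeval x (amanoTrinomial p t w m l) =
      x ^ p - (algebraMap K F w * algebraMap K F t ^ m * x ^ l + algebraMap K F t) := by
  simp [amanoTrinomial, sub_sub]

theorem separable_amanoTrinomial [Fact p.Prime] [CharP K p] (ht : t ≠ 0) (hw : w ≠ 0)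
    (hl : 1 ≤ l) (hl0 : (l : K) ≠ 0) : (amanoTrinomial p t w m l).Separable := by
  have hp : 1 ≤ p := (Fact.out : p.Prime).one_le
  have hd : derivative (amanoTrinomial p t w m l) = C (-(w * t ^ m * l)) * X ^ (l - 1) := by
    rw [amanoTrinomial, derivative_sub, derivative_sub, derivative_C_mul_X_pow, derivative_X_pow,
      derivative_C, CharP.cast_eq_zero, C_0, zero_mul, zero_sub, sub_zero, C_neg, neg_mul]
  have hX : IsCoprime (amanoTrinomial p t w m l) X := by
    refine ⟨C (-t⁻¹), C t⁻¹ * (X ^ (p - 1) - C (w * t ^ m) * X ^ (l - 1)), ?_⟩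
    have htt : (C t⁻¹ * C t : K[X]) = 1 := by rw [← C_mul, inv_mul_cancel₀ ht, C_1]
    rw [amanoTrinomial, ← pow_sub_mul_pow X hp, ← pow_sub_mul_pow X hl, map_neg]
    linear_combination htt
  rw [separable_def, hd]
  refine (isCoprime_mul_unit_left_right (isUnit_C.mpr ?_) _ _).mpr hX.pow_right
  exact (neg_ne_zero.mpr (mul_ne_zero (mul_ne_zero hw (pow_ne_zero _ ht)) hl0)).isUnit

end Polynomial

theorem natCast_ne_zero_of_lt (p : ℕ) {R : Type*} [AddMonoidWithOne R] [CharP R p] {l : ℕ}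
    (hl : 1 ≤ l) (hlp : l < p) : (l : R) ≠ 0 := by
  rw [Ne, CharP.cast_eq_zero_iff R p]
  exact Nat.not_dvd_of_pos_of_lt hl hlp

section Root

variable {K Ks : Type*} [Field K] [Field Ks] [Algebra K Ks]

/-- The conditions on a prime element `t` and a unit `w` of the valuation ring under which Amano's
theory applies to the trinomial `X ^ p - w t ^ m X ^ l - t`. -/
structure IsAmanoDatum (𝒪 : ValuationSubring K) (p m l : ℕ) (t w : 𝒪) : Prop where
  irreducible : Irreducible t
  isUnit : IsUnit w
  one_le_m : 1 ≤ m
  one_le_l : 1 ≤ l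
  l_lt : l < p

namespace IsAmanoDatum

variable {𝒪 : ValuationSubring K} [Algebra.IsAlgebraic K Ks] [IsDiscreteValuationRing 𝒪]
  [IsAdicComplete (maximalIdeal 𝒪) 𝒪] {p m l : ℕ} [NeZero p] {t w : 𝒪}
  (h : IsAmanoDatum 𝒪 p m l t w)

local notation "ν" => scaledOrd 𝒪 Ks p

include h

theorem scaledOrd_prime : ν (algebraMap K Ks t) = (p : ℚ) :=
  (scaledOrd_algebraMap_eq_natCast_iff 𝒪 p).mpr h.irreducible

theorem scaledOrd_unit : ν (algebraMap K Ks w) = 0 :=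
  (scaledOrd_algebraMap_eq_zero_iff 𝒪 p h.isUnit.ne_zero).mpr h.isUnit

theorem scaledOrd_middle_term {x : Ks} {r : ℚ} (hx : ν x = r) :
    ν (algebraMap K Ks w * algebraMap K Ks t ^ m * x ^ l) = ((m * p + l * r : ℚ) : WithTop ℚ) := by
  rw [AddValuation.map_mul, AddValuation.map_mul, h.scaledOrd_unit,
    map_pow_of_eq_coe h.scaledOrd_prime, map_pow_of_eq_coe hx, zero_add, WithTop.coe_add]

end IsAmanoDatum

/-- `π` is a root of the trinomial `X ^ p - w t ^ m X ^ l - t` of Amano's type. -/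
structure IsAmanoRoot (𝒪 : ValuationSubring K) (p m l : ℕ) (t w : 𝒪) (π : Ks) : Prop
    extends IsAmanoDatum 𝒪 p m l t w where
  pow_eq : π ^ p = algebraMap K Ks w * algebraMap K Ks t ^ m * π ^ l + algebraMap K Ks t

namespace IsAmanoRoot

variable {𝒪 : ValuationSubring K} {p m l : ℕ} {t w : 𝒪} {π ρ : Ks}

theorem map (h : IsAmanoRoot 𝒪 p m l t w π) (g : Ks ≃ₐ[K] Ks) : IsAmanoRoot 𝒪 p m l t w (g π) :=
  { h with pow_eq := by simpa using congrArg g h.pow_eq }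

theorem aeval_eq_zero (h : IsAmanoRoot 𝒪 p m l t w π) :
    aeval π (amanoTrinomial p (t : K) w m l) = 0 := by
  rw [aeval_amanoTrinomial, h.pow_eq, sub_self]

theorem ne_zero [NeZero p] (h : IsAmanoRoot 𝒪 p m l t w π) : π ≠ 0 := by
  rintro rfl
  have hpow := h.pow_eq
  rw [zero_pow (NeZero.ne p), zero_pow (Nat.one_le_iff_ne_zero.mp h.one_le_l), mul_zero, zero_add,
    eq_comm, map_eq_zero] at hpow
  exact h.irreducible.ne_zero (Subtype.ext hpow)

theorem mul_div_sub_one_pow_eq [Fact p.Prime] [CharP K p] (h : IsAmanoRoot 𝒪 p m l t w π)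
    (h' : IsAmanoRoot 𝒪 p m l t w ρ) : π ^ p * (ρ / π - 1) ^ p =
      algebraMap K Ks w * algebraMap K Ks t ^ m * π ^ l * ((1 + (ρ / π - 1)) ^ l - 1) := by
  have : CharP Ks p := charP_of_injective_algebraMap (algebraMap K Ks).injective p
  have hρ : π * (ρ / π) = ρ := mul_div_cancel₀ _ h.ne_zero
  calc π ^ p * (ρ / π - 1) ^ p = ρ ^ p - π ^ p := by
        rw [← mul_pow, mul_sub, hρ, mul_one, sub_pow_char]
    _ = _ := by
      rw [add_sub_cancel, mul_sub, mul_assoc _ (π ^ l), ← mul_pow, hρ, h.pow_eq, h'.pow_eq]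
      ring

variable [Algebra.IsAlgebraic K Ks] [IsDiscreteValuationRing 𝒪]
  [IsAdicComplete (maximalIdeal 𝒪) 𝒪]

local notation "ν" => scaledOrd 𝒪 Ks p

section NeZero

variable [NeZero p] (h : IsAmanoRoot 𝒪 p m l t w π)

include h

theorem scaledOrd_pos : 0 < ν π := by
  obtain ⟨r, hr⟩ := WithTop.ne_top_iff_exists.mp ((ν).ne_top_iff.mpr h.ne_zero)
  have hp : (0 : ℚ) < p := Nat.cast_pos.mpr (NeZero.pos p)
  have hm : (1 : ℚ) ≤ m := Nat.one_le_cast.mpr h.one_le_m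
  have hlp : (l : ℚ) < p := Nat.cast_lt.mpr h.l_lt
  by_contra! hneg
  rw [← hr, ← WithTop.coe_zero, WithTop.coe_le_coe] at hneg
  refine lt_irrefl (ν (π ^ p)) ?_
  conv_rhs => rw [h.pow_eq]
  refine (ν).map_lt_add ?_ ?_
  · rw [map_pow_of_eq_coe hr.symm, h.scaledOrd_middle_term hr.symm, WithTop.coe_lt_coe]
    nlinarith
  · rw [map_pow_of_eq_coe hr.symm, h.scaledOrd_prime, WithTop.coe_lt_coe]
    nlinarith

theorem sameLeadingTerm_pow : SameLeadingTerm ν (π ^ p) (algebraMap K Ks t) := by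
  obtain ⟨r, hr⟩ := WithTop.ne_top_iff_exists.mp ((ν).ne_top_iff.mpr h.ne_zero)
  have hpos := h.scaledOrd_pos
  have hp : (0 : ℚ) < p := Nat.cast_pos.mpr (NeZero.pos p)
  have hm : (1 : ℚ) ≤ m := Nat.one_le_cast.mpr h.one_le_m
  have hl : (1 : ℚ) ≤ l := Nat.one_le_cast.mpr h.one_le_l
  rw [← hr, ← WithTop.coe_zero, WithTop.coe_lt_coe] at hpos
  rw [SameLeadingTerm, h.pow_eq, add_sub_cancel_right, h.scaledOrd_middle_term hr.symm,
    h.scaledOrd_prime, WithTop.coe_lt_coe]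
  nlinarith

theorem scaledOrd_eq_one : ν π = 1 := by
  obtain ⟨r, hr⟩ := WithTop.ne_top_iff_exists.mp ((ν).ne_top_iff.mpr h.ne_zero)
  have hpow := h.sameLeadingTerm_pow.map_eq
  rw [map_pow_of_eq_coe hr.symm, h.scaledOrd_prime, WithTop.coe_inj,
    mul_eq_left₀ (Nat.cast_ne_zero.mpr (NeZero.ne p))] at hpow
  rw [← hr, hpow, WithTop.coe_one]

theorem finrank_adjoin : Module.finrank K K⟮π⟯ = p := by
  have hint : IsIntegral K π := Algebra.IsIntegral.isIntegral π
  have hle := natDegree_le_natDegree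
    (minpoly.min K π (monic_amanoTrinomial h.l_lt) h.aeval_eq_zero)
  rw [natDegree_amanoTrinomial h.l_lt, ← IntermediateField.adjoin.finrank hint] at hle
  have := IntermediateField.adjoin.finiteDimensional hint
  exact hle.antisymm (Nat.le_of_dvd Module.finrank_pos
    (dvd_finrank_adjoin 𝒪 p h.scaledOrd_eq_one))

theorem isPrimeElement : IsPrimeElement 𝒪 p K⟮π⟯ π :=
  ⟨h.finrank_adjoin, IntermediateField.mem_adjoin_simple_self K π, h.scaledOrd_eq_one⟩

theorem minpoly_eq : minpoly K π = amanoTrinomial p (t : K) w m l := by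
  have hint : IsIntegral K π := Algebra.IsIntegral.isIntegral π
  refine (Polynomial.eq_of_monic_of_dvd_of_natDegree_le (minpoly.monic hint)
    (monic_amanoTrinomial h.l_lt) (minpoly.dvd K π h.aeval_eq_zero) ?_).symm
  rw [natDegree_amanoTrinomial h.l_lt, ← IntermediateField.adjoin.finrank hint, h.finrank_adjoin]

end NeZero

section CharP

variable [Fact p.Prime] [CharP K p] (h : IsAmanoRoot 𝒪 p m l t w π)
  (h' : IsAmanoRoot 𝒪 p m l t w ρ)

include h h'

theorem scaledOrd_div_sub_one_pos : 0 < ν (ρ / π - 1) := by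
  have hdiv : ν (ρ / π) = 0 := by
    rw [AddValuation.map_div, h.scaledOrd_eq_one, h'.scaledOrd_eq_one,
      LinearOrderedAddCommGroupWithTop.sub_self_eq_zero_of_ne_top WithTop.one_ne_top]
  have hnonneg : 0 ≤ ν (ρ / π - 1) := (ν).map_le_sub hdiv.ge (ν).map_one.ge
  have hle := le_map_one_add_pow_sub_one hnonneg l
  have hm : (1 : ℚ) ≤ m := Nat.one_le_cast.mpr h.one_le_m
  have hl : (1 : ℚ) ≤ l := Nat.one_le_cast.mpr h.one_le_l
  refine pos_of_map_pow_pos (n := p) ?_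
  have hmul : ν (π ^ p * 1) < ν (π ^ p * (ρ / π - 1) ^ p) := by
    rw [h.mul_div_sub_one_pow_eq h', AddValuation.map_mul _ (_ * π ^ l),
      h.scaledOrd_middle_term (r := 1) h.scaledOrd_eq_one, mul_one,
      map_pow_of_eq_coe (r := 1) h.scaledOrd_eq_one]
    refine lt_add_of_lt_of_nonneg (WithTop.coe_lt_coe.mpr ?_) (hnonneg.trans hle)
    nlinarith [(p.cast_nonneg : (0 : ℚ) ≤ p)]
  rwa [map_lt_map_mul_left_iff (pow_ne_zero p h.ne_zero), AddValuation.map_one] at hmul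

theorem sameLeadingTerm_div_sub_one_pow {n : ℕ} (hn : n + p = m * p + l) (hne : ρ ≠ π) :
    SameLeadingTerm ν ((ρ / π - 1) ^ (p - 1)) (l * (algebraMap K Ks w * π ^ n)) := by
  have : CharP Ks p := charP_of_injective_algebraMap (algebraMap K Ks).injective p
  have hπ := h.ne_zero
  set ε := ρ / π - 1 with hε
  have hε0 : ε ≠ 0 := by rwa [hε, sub_ne_zero, Ne, div_eq_one_iff_eq hπ]
  have hw0 : algebraMap K Ks w ≠ 0 := by simpa using h.isUnit.ne_zero
  have hbinom : SameLeadingTerm ν ((1 + ε) ^ l - 1) (l * ε) := by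
    simpa using sameLeadingTerm_sum_mul_one_add_pow_sub_one (c := fun _ => 1)
      (Finset.mem_singleton_self l)
      (map_natCast_eq_zero p (Nat.not_dvd_of_pos_of_lt h.one_le_l h.l_lt)) hε0
      (h.scaledOrd_div_sub_one_pos h') one_ne_zero (by simp +contextual)
  have hlead := (((SameLeadingTerm.refl hw0).mul (h.sameLeadingTerm_pow.symm.pow m)).mul
    (.refl (pow_ne_zero l hπ))).mul hbinom
  rw [← h.mul_div_sub_one_pow_eq h', ← hε] at hlead
  refine .of_mul_left (mul_ne_zero (pow_ne_zero p hπ) hε0) ?_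
  convert hlead using 1
  · rw [mul_assoc, mul_pow_sub_one (NeZero.ne p)]
  · have hpow : π ^ n * π ^ p = (π ^ p) ^ m * π ^ l := by
      rw [← pow_add, hn, pow_add, pow_mul']
    linear_combination algebraMap K Ks w * l * ε * hpow

theorem scaledOrd_div_sub_one {n : ℕ} (hn : n + p = m * p + l) {b : ℚ}
    (hb : ((p : ℚ) - 1) * b = n) (hne : ρ ≠ π) : ν (ρ / π - 1) = b := by
  have : CharP Ks p := charP_of_injective_algebraMap (algebraMap K Ks).injective p
  have hp : (1 : ℚ) < p := Nat.one_lt_cast.mpr (Fact.out : p.Prime).one_lt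
  have hε0 : ρ / π - 1 ≠ 0 := by rwa [sub_ne_zero, Ne, div_eq_one_iff_eq h.ne_zero]
  obtain ⟨r, hr⟩ := WithTop.ne_top_iff_exists.mp ((ν).ne_top_iff.mpr hε0)
  have hval := (h.sameLeadingTerm_div_sub_one_pow h' hn hne).map_eq
  rw [map_pow_of_eq_coe hr.symm, AddValuation.map_mul, AddValuation.map_mul, h.scaledOrd_unit,
    map_natCast_eq_zero p (Nat.not_dvd_of_pos_of_lt h.one_le_l h.l_lt), zero_add, zero_add,
    map_pow_of_eq_coe (r := 1) h.scaledOrd_eq_one, mul_one, WithTop.coe_inj,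
    Nat.cast_pred (NeZero.pos p), ← hb, mul_right_inj' (sub_ne_zero.mpr hp.ne')] at hval
  rw [← hr, hval]

theorem scaledOrd_sub {n : ℕ} (hn : n + p = m * p + l) {b : ℚ}
    (hb : ((p : ℚ) - 1) * b = n) (hne : ρ ≠ π) : ν (ρ - π) = ((b + 1 : ℚ) : WithTop ℚ) := by
  have hsub : ρ - π = (ρ / π - 1) * π := by rw [sub_mul, div_mul_cancel₀ _ h.ne_zero, one_mul]
  rw [hsub, AddValuation.map_mul, h.scaledOrd_div_sub_one h' hn hb hne, h.scaledOrd_eq_one,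
    WithTop.coe_add, WithTop.coe_one]

omit h' in
theorem mem_extensionsWithBreak [IsGalois K Ks] {n : ℕ} (hn : n + p = m * p + l) {b : ℚ}
    (hb : ((p : ℚ) - 1) * b = n) : K⟮π⟯ ∈ extensionsWithBreak Ks 𝒪 p b := by
  have hprime := h.isPrimeElement
  obtain ⟨g, hg⟩ := hprime.exists_algEquiv_ne (Fact.out : p.Prime).ne_one
  refine ⟨hprime.finrank_eq, hprime.isTotallyRamified, (g : Ks →ₐ[K] Ks).comp K⟮π⟯.val,
    fun heq => hg (DFunLike.congr_fun heq ⟨π, hprime.mem⟩), ⟨π, hprime.mem⟩, ?_, ?_⟩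
  · rw [ordOf_eq_scaledOrd 𝒪 p hprime.finrank_eq]
    exact hprime.scaledOrd_eq_one
  · rw [ordOf_eq_scaledOrd 𝒪 p hprime.finrank_eq]
    exact h.scaledOrd_sub (h.map g) hn hb hg

end CharP

end IsAmanoRoot

end Root

section CoefficientField

variable {R : Type*} [CommRing R] [IsDomain R] [IsDiscreteValuationRing R]

theorem mem_maximalIdeal_pow_iff_dvd {t : R} (ht : Irreducible t) {n : ℕ} {x : R} :
    x ∈ maximalIdeal R ^ n ↔ t ^ n ∣ x := by
  rw [ht.maximalIdeal_eq, Ideal.span_singleton_pow, Ideal.mem_span_singleton]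

variable {σ : ResidueField R →+* R} (hσ : ∀ a, residue R (σ a) = a) {t t' : R}

include hσ

theorem exists_sub_eval₂_mem (ht : Irreducible t) (x : R) (n : ℕ) :
    ∃ P : (ResidueField R)[X], x - P.eval₂ σ t ∈ maximalIdeal R ^ n := by
  simp only [mem_maximalIdeal_pow_iff_dvd ht]
  induction n with
  | zero => exact ⟨0, by simp⟩
  | succ n ih =>
    obtain ⟨P, y, hy⟩ := ih
    have hres : y - σ (residue R y) ∈ maximalIdeal R := by
      rw [← residue_eq_zero_iff, map_sub, hσ, sub_self]
    rw [ht.maximalIdeal_eq, Ideal.mem_span_singleton] at hres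
    obtain ⟨z, hz⟩ := hres
    refine ⟨P + C (residue R y) * X ^ n, z, ?_⟩
    rw [eval₂_add, eval₂_mul, eval₂_C, eval₂_pow, eval₂_X]
    linear_combination hy + t ^ n * hz

theorem eval₂_mem_maximalIdeal_pow_iff (ht : Irreducible t) (P : (ResidueField R)[X]) (n : ℕ) :
    P.eval₂ σ t ∈ maximalIdeal R ^ n ↔ X ^ n ∣ P := by
  rw [mem_maximalIdeal_pow_iff_dvd ht]
  refine ⟨?_, fun h => by simpa using map_dvd (eval₂RingHom σ t) h⟩
  induction n with
  | zero => simp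
  | succ n ih =>
    intro h
    obtain ⟨Q, rfl⟩ := ih ((pow_dvd_pow t n.le_succ).trans h)
    rw [eval₂_mul, eval₂_pow, eval₂_X, pow_succ,
      mul_dvd_mul_iff_left (pow_ne_zero _ ht.ne_zero), ← Ideal.mem_span_singleton,
      ← ht.maximalIdeal_eq, ← residue_eq_zero_iff, hom_eval₂,
      (residue_eq_zero_iff t).mpr ((mem_maximalIdeal t).mpr ht.not_isUnit),
      show (residue R).comp σ = RingHom.id _ from RingHom.ext hσ, eval₂_at_zero,
      RingHom.id_apply] at h
    rwa [pow_succ, mul_dvd_mul_iff_left (pow_ne_zero _ X_ne_zero), X_dvd_iff]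

theorem exists_quotient_ringHom_map_eval₂ (ht : Irreducible t) (ht' : Irreducible t') (n : ℕ) :
    ∃ f : R ⧸ maximalIdeal R ^ n →+* R ⧸ maximalIdeal R ^ n, ∀ P : (ResidueField R)[X],
      f (Ideal.Quotient.mk _ (P.eval₂ σ t)) = Ideal.Quotient.mk _ (P.eval₂ σ t') := by
  let ev (u : R) : (ResidueField R)[X] →+* R ⧸ maximalIdeal R ^ n :=
    (Ideal.Quotient.mk _).comp (eval₂RingHom σ u)
  have hker {u : R} (hu : Irreducible u) (P : (ResidueField R)[X]) : ev u P = 0 ↔ X ^ n ∣ P :=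
    Ideal.Quotient.eq_zero_iff_mem.trans (eval₂_mem_maximalIdeal_pow_iff hσ hu P n)
  have hsurj : Function.Surjective (ev t) := by
    intro y
    obtain ⟨x, rfl⟩ := Ideal.Quotient.mk_surjective y
    obtain ⟨P, hP⟩ := exists_sub_eval₂_mem hσ ht x n
    exact ⟨P, ((Ideal.Quotient.mk_eq_mk_iff_sub_mem _ _).mpr hP).symm⟩
  exact ⟨(ev t).liftOfSurjective hsurj ⟨ev t', fun P hP => (hker ht' P).mpr ((hker ht P).mp hP)⟩,
    (ev t).liftOfSurjective_comp_apply hsurj _⟩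

theorem ringHom_eq_id_of_map_eval₂ [IsHausdorff (maximalIdeal R) R] (ht : Irreducible t)
    {φ : R →+* R} (hφ : ∀ P : (ResidueField R)[X], φ (P.eval₂ σ t) = P.eval₂ σ t) :
    φ = RingHom.id R := by
  have hφt : φ t = t := by simpa using hφ X
  ext1 x
  refine IsHausdorff.eq_iff_smodEq (I := maximalIdeal R) |>.mpr fun n => ?_
  obtain ⟨P, hP⟩ := exists_sub_eval₂_mem hσ ht x n
  have hφP : φ (x - P.eval₂ σ t) ∈ maximalIdeal R ^ n := by
    rw [mem_maximalIdeal_pow_iff_dvd ht] at hP ⊢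
    simpa [hφt] using map_dvd φ hP
  rw [smul_eq_mul, Ideal.mul_top, SModEq.sub_mem, RingHom.id_apply]
  rw [map_sub, hφ] at hφP
  simpa using sub_mem hφP hP

variable [IsAdicComplete (maximalIdeal R) R]

theorem exists_ringHom_map_eval₂ (ht : Irreducible t) (ht' : Irreducible t') :
    ∃ φ : R →+* R, ∀ P : (ResidueField R)[X], φ (P.eval₂ σ t) = P.eval₂ σ t' := by
  choose f hf using exists_quotient_ringHom_map_eval₂ hσ ht ht'
  let F (n : ℕ) : R →+* R ⧸ maximalIdeal R ^ n := (f n).comp (Ideal.Quotient.mk _)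
  have hF {n : ℕ} {x y : R} (h : x - y ∈ maximalIdeal R ^ n) : F n x = F n y :=
    congrArg (f n) (Ideal.Quotient.eq.mpr h)
  have hcompat {a b : ℕ} (hab : a ≤ b) :
      (Ideal.Quotient.factorPow (maximalIdeal R) hab).comp (F b) = F a := by
    ext x
    obtain ⟨P, hP⟩ := exists_sub_eval₂_mem hσ ht x b
    rw [RingHom.comp_apply, hF hP, hF (Ideal.pow_le_pow_right hab hP)]
    exact (congrArg (Ideal.Quotient.factorPow _ hab) (hf b P)).trans (hf a P).symm
  refine ⟨IsAdicComplete.liftRingHom _ F hcompat, fun P => ?_⟩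
  refine IsHausdorff.eq_iff_smodEq (I := maximalIdeal R) |>.mpr fun n => ?_
  rw [smul_eq_mul, Ideal.mul_top]
  exact (IsAdicComplete.mk_liftRingHom _ F hcompat n _).trans (hf n P)

theorem exists_ringEquiv_map_eval₂ (ht : Irreducible t) (ht' : Irreducible t') :
    ∃ φ : R ≃+* R, ∀ P : (ResidueField R)[X], φ (P.eval₂ σ t) = P.eval₂ σ t' := by
  obtain ⟨φ, hφ⟩ := exists_ringHom_map_eval₂ hσ ht ht'
  obtain ⟨ψ, hψ⟩ := exists_ringHom_map_eval₂ hσ ht' ht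
  exact ⟨RingEquiv.ofRingHom φ ψ
    (ringHom_eq_id_of_map_eval₂ hσ ht' fun P => by rw [RingHom.comp_apply, hψ, hφ])
    (ringHom_eq_id_of_map_eval₂ hσ ht fun P => by rw [RingHom.comp_apply, hφ, hψ]), hφ⟩

end CoefficientField

section Teichmuller

variable {K : Type*} [Field K] (p : ℕ) [CharP K p] (𝒪 : ValuationSubring K)

theorem charP_valuationSubring : CharP 𝒪 p :=
  ⟨fun x => by rw [← CharP.cast_eq_zero_iff K p x, ← ZeroMemClass.coe_eq_zero]; simp⟩

variable [hp : Fact p.Prime] [IsAdicComplete (maximalIdeal 𝒪) 𝒪]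

theorem exists_pow_eq_one_add {y : 𝒪} (hy : y ∈ maximalIdeal 𝒪) {N : ℕ} (hN : ¬p ∣ N) :
    ∃ z : 𝒪, z ^ N = 1 + y := by
  have hc : CharP (ResidueField 𝒪) p := charP_residueField p 𝒪
  have hN0 : N ≠ 0 := fun h => hN (h ▸ dvd_zero p)
  have hderiv : IsUnit (residue 𝒪 ((derivative (X ^ N - C (1 + y))).eval 1)) := by
    rw [derivative_sub, derivative_X_pow, derivative_C]
    simpa [CharP.cast_eq_zero_iff (ResidueField 𝒪) p] using hN
  obtain ⟨z, hz, -⟩ := HenselianRing.is_henselian (I := maximalIdeal 𝒪)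
    (X ^ N - C (1 + y)) (monic_X_pow_sub_C _ hN0) 1 (by simpa using hy) hderiv
  exact ⟨z, by simpa [sub_eq_zero] using hz⟩

variable [PerfectField (ResidueField 𝒪)]

theorem residue_teichmuller (a : ResidueField 𝒪) : residue 𝒪 (teichmuller p 𝒪 a) = a :=
  have : CharP (𝒪 ⧸ maximalIdeal 𝒪) p := charP_residueField p 𝒪
  Perfection.mk_teichmuller _

-- Writing `a` and `b` as `p ^ n`-th powers gives the congruence modulo `𝔪 ^ p ^ n` for every `n`.
theorem teichmuller_add (a b : ResidueField 𝒪) :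
    teichmuller p 𝒪 (a + b) = teichmuller p 𝒪 a + teichmuller p 𝒪 b := by
  have : CharP (ResidueField 𝒪) p := charP_residueField p 𝒪
  have : PerfectRing (ResidueField 𝒪) p := PerfectField.toPerfectRing p
  have : CharP 𝒪 p := charP_valuationSubring p 𝒪
  refine IsHausdorff.eq_iff_smodEq (I := maximalIdeal 𝒪) |>.mpr fun n => ?_
  rw [smul_eq_mul, Ideal.mul_top, SModEq.sub_mem]
  obtain ⟨a, rfl⟩ := (iterateFrobeniusEquiv (ResidueField 𝒪) p n).surjective a
  obtain ⟨b, rfl⟩ := (iterateFrobeniusEquiv (ResidueField 𝒪) p n).surjective b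
  rw [← map_add (iterateFrobeniusEquiv (ResidueField 𝒪) p n)]
  simp only [iterateFrobeniusEquiv_def, map_pow]
  rw [← add_pow_char_pow, ← sub_pow_char_pow]
  refine Ideal.pow_le_pow_right (Nat.lt_pow_self hp.out.one_lt).le (Ideal.pow_mem_pow ?_ _)
  rw [← residue_eq_zero_iff, map_sub, map_add (residue 𝒪)]
  simp only [residue_teichmuller, sub_self]

/-- The Teichmüller lift as a ring homomorphism, which exhibits the residue field as a coefficient
field of `𝒪`. -/
noncomputable def teichmullerHom : ResidueField 𝒪 →+* 𝒪 :=
  RingHom.mk' (teichmuller p 𝒪) (teichmuller_add p 𝒪)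

theorem exists_ringEquiv_map_prime [IsDiscreteValuationRing 𝒪] {t t' : 𝒪} (ht : Irreducible t)
    (ht' : Irreducible t') : ∃ φ : K ≃+* K, φ t = t' ∧ FixesResidueField p 𝒪 φ := by
  obtain ⟨φ, hφ⟩ := exists_ringEquiv_map_eval₂ (σ := teichmullerHom p 𝒪)
    (residue_teichmuller p 𝒪) ht ht'
  have hφt : φ t = t' := by simpa using hφ X
  have hφa (a : ResidueField 𝒪) : φ (teichmuller p 𝒪 a) = teichmuller p 𝒪 a := by
    simpa using! hφ (C a)
  have hext := IsFractionRing.ringEquivOfRingEquiv_algebraMap (K := K) (L := K) φ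
  exact ⟨IsFractionRing.ringEquivOfRingEquiv φ, (hext t).trans (congrArg _ hφt),
    fun a => (hext _).trans (congrArg _ (hφa a))⟩

end Teichmuller

section Automorphism

variable {K : Type*} [Field K] (𝒪 : ValuationSubring K) [IsDiscreteValuationRing 𝒪]

theorem ordBase_eq_zero_of_forall_exists_pow_eq (p : ℕ) [Fact p.Prime] {a : K} (ha : a ≠ 0)
    (h : ∀ N : ℕ, ¬p ∣ N → ∃ z : K, z ^ N = a) : ordBase 𝒪 a = 0 := by
  have hp : p.Prime := Fact.out
  obtain ⟨z, hz⟩ := h (p * (ordBase 𝒪 a).natAbs + 1) fun hdvd =>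
    hp.not_dvd_one ((Nat.dvd_add_right (dvd_mul_right p _)).mp hdvd)
  have hz0 : z ≠ 0 := by
    rintro rfl
    exact ha (by rw [← hz, zero_pow (Nat.succ_ne_zero _)])
  have hdvd : ((p * (ordBase 𝒪 a).natAbs + 1 : ℕ) : ℤ) ∣ ordBase 𝒪 a :=
    ⟨ordBase 𝒪 z, by rw [← ordBase_pow 𝒪 hz0, hz]⟩
  refine Int.eq_zero_of_abs_lt_dvd hdvd ?_
  rw [Int.abs_eq_natAbs]
  exact mod_cast Nat.lt_succ_of_le (Nat.le_mul_of_pos_left _ hp.pos)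

variable (p : ℕ) [hp : Fact p.Prime] [CharP K p] [IsAdicComplete (maximalIdeal 𝒪) 𝒪]

include p

theorem ringEquiv_mem_of_mem_maximalIdeal (φ : K ≃+* K) {y : 𝒪} (hy : y ∈ maximalIdeal 𝒪) :
    φ y ∈ 𝒪 := by
  have hunit : IsUnit (1 + y) := by
    rw [← residue_ne_zero_iff_isUnit, map_add, (residue_eq_zero_iff y).mpr hy]
    simp
  have hφ : φ ((1 + y : 𝒪) : K) ≠ 0 := by
    rw [_root_.map_ne_zero]
    exact Subtype.coe_ne_coe.mpr hunit.ne_zero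
  have hord := ordBase_eq_zero_of_forall_exists_pow_eq 𝒪 p hφ fun N hN => by
    obtain ⟨z, hz⟩ := exists_pow_eq_one_add p 𝒪 hy hN
    exact ⟨φ z, by rw [← map_pow]; exact congrArg φ (congrArg Subtype.val hz)⟩
  have hmem := (ordBase_nonneg_iff 𝒪 hφ).mp hord.ge
  simpa using sub_mem hmem (one_mem 𝒪)

theorem ringEquiv_mem (φ : K ≃+* K) {x : K} (hx : x ∈ 𝒪) : φ x ∈ 𝒪 := by
  obtain ⟨t, ht⟩ := IsDiscreteValuationRing.exists_irreducible 𝒪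
  rcases eq_or_ne x 0 with rfl | hx0
  · simp
  have hφx : φ x ≠ 0 := by simpa using hx0
  have hφt : φ t ≠ 0 := by simpa using ht.ne_zero
  have hmem (N : ℕ) : 0 ≤ N * ordBase 𝒪 (φ x) + ordBase 𝒪 (φ t) := by
    rw [← ordBase_pow 𝒪 hφx, ← ordBase_mul 𝒪 (pow_ne_zero N hφx) hφt, ← map_pow, ← map_mul,
      ordBase_nonneg_iff 𝒪 (by simp [hx0, ht.ne_zero])]
    exact ringEquiv_mem_of_mem_maximalIdeal 𝒪 p φ (y := ⟨x, hx⟩ ^ N * t)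
      (Ideal.mul_mem_left _ _ ((mem_maximalIdeal t).mpr ht.not_isUnit))
  rw [← ordBase_nonneg_iff 𝒪 hφx]
  by_contra! hneg
  have hlarge := hmem ((ordBase 𝒪 (φ t)).natAbs + 1)
  push_cast at hlarge
  nlinarith [le_abs_self (ordBase 𝒪 (φ t)), abs_nonneg (ordBase 𝒪 (φ t))]

theorem ringEquiv_map_irreducible (φ : K ≃+* K) {t : 𝒪} (ht : Irreducible t) :
    ∃ t' : 𝒪, Irreducible t' ∧ (t' : K) = φ t := by
  let e : 𝒪 ≃+* 𝒪 :=
    { toFun := fun x => ⟨φ x, ringEquiv_mem 𝒪 p φ x.2⟩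
      invFun := fun x => ⟨φ.symm x, ringEquiv_mem 𝒪 p φ.symm x.2⟩
      left_inv := fun x => Subtype.ext (by simp)
      right_inv := fun x => Subtype.ext (by simp)
      map_mul' := fun x y => Subtype.ext (by simp)
      map_add' := fun x y => Subtype.ext (by simp) }
  exact ⟨e t, (MulEquiv.irreducible_iff e).mpr ht, rfl⟩

end Automorphism

section Improvement

variable {F Γ : Type*} [Field F] [LinearOrderedAddCommGroupWithTop Γ] {v : AddValuation F Γ}

theorem le_map_pow_succ_sub_pow_succ {x y : F} {r : Γ} (hx : r ≤ v x) (hy : r ≤ v y) (n : ℕ) :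
    n • r + v (x - y) ≤ v (x ^ (n + 1) - y ^ (n + 1)) := by
  rw [← (Commute.all x y).geom_sum₂_mul, v.map_mul]
  gcongr
  refine v.map_le_sum fun i hi => ?_
  have hin : i + (n + 1 - 1 - i) = n := by
    rw [Finset.mem_range] at hi
    lia
  rw [v.map_mul, v.map_pow, v.map_pow]
  calc n • r = i • r + (n + 1 - 1 - i) • r := by rw [← add_nsmul, hin]
    _ ≤ _ := by gcongr

theorem two_nsmul_le_map_one_add_pow_mul_sub {ε δ : F} (hε : 0 ≤ v ε) (hδ : 2 • v ε ≤ v δ)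
    (m l : ℕ) : 2 • v ε ≤ v ((1 + δ) ^ m * (1 + ε) ^ l - 1 - l * ε) := by
  have hsplit : (1 + δ) ^ m * (1 + ε) ^ l - 1 - l * ε =
      (1 + ε) ^ l * ((1 + δ) ^ m - 1) + ((1 + ε) ^ l - 1 - l * ε) := by ring
  rw [hsplit]
  refine v.map_le_add ?_ (two_nsmul_le_map_one_add_pow_sub hε l)
  rw [v.map_mul, v.map_pow]
  exact le_add_of_nonneg_of_le (nsmul_nonneg (v.map_le_add v.map_one.ge hε) l)
    (hδ.trans (le_map_one_add_pow_sub_one ((nsmul_nonneg hε 2).trans hδ) m))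

-- Replacing `y` by `y (1 + E y ^ s)` and `T` by `T (1 + E ^ p T ^ s)` changes `y ^ p` and `T` by
-- nearly the same amount, because `y ^ p` is close to `T`; what remains is the linear change of the
-- middle term, which can be made to cancel the leading term of the error.
theorem mul_one_add_pow_sub_eq (p : ℕ) [Fact p.Prime] [CharP F p] (y T A E : F) (m l s : ℕ) :
    (y * (1 + E * y ^ s)) ^ p -
        (A * (T * (1 + E ^ p * T ^ s)) ^ m * (y * (1 + E * y ^ s)) ^ l +
          T * (1 + E ^ p * T ^ s)) =
      (y ^ p - (A * T ^ m * y ^ l + T) - l * (A * T ^ m * y ^ l) * y ^ s * E) +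
        E ^ p * ((y ^ p) ^ (s + 1) - T ^ (s + 1)) -
        A * T ^ m * y ^ l *
          ((1 + E ^ p * T ^ s) ^ m * (1 + E * y ^ s) ^ l - 1 - l * (E * y ^ s)) := by
  rw [mul_pow y _ p, mul_pow y _ l, mul_pow T _ m, add_pow_char]
  ring

end Improvement

section Approximation

variable {K Ks : Type*} [Field K] [Field Ks] [Algebra K Ks] [Algebra.IsAlgebraic K Ks]
  {𝒪 : ValuationSubring K} [IsDiscreteValuationRing 𝒪] [IsAdicComplete (maximalIdeal 𝒪) 𝒪]
  {L : IntermediateField K Ks}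

namespace IsPrimeElement

variable {e : ℕ} [NeZero e] {π : Ks} (h : IsPrimeElement 𝒪 e L π)

local notation "ν" => scaledOrd 𝒪 Ks e

include h

theorem add_one_le_scaledOrd {x : Ks} (hx : x ∈ L) {k : ℕ} (hk : ((k : ℚ) : WithTop ℚ) < ν x) :
    ((k + 1 : ℚ) : WithTop ℚ) ≤ ν x := by
  rcases eq_or_ne x 0 with rfl | hx0
  · simp
  obtain ⟨z, hz⟩ := h.exists_scaledOrd_eq_intCast hx hx0
  rw [hz, WithTop.coe_lt_coe] at hk
  rw [hz, WithTop.coe_le_coe]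
  have hkz : (k : ℤ) < z := mod_cast hk
  exact_mod_cast Int.add_one_le_iff.mpr hkz

theorem exists_add_one_le_scaledOrd_sub_mul {x y : Ks} (hx : x ∈ L) (hy : y ∈ L) (hy0 : y ≠ 0)
    (hyx : ν y ≤ ν x) : ∃ c : 𝒪, ν y + 1 ≤ ν (x - y * algebraMap K Ks c) := by
  have hxy : y * (x / y) = x := mul_div_cancel₀ _ hy0
  have hnonneg : 0 ≤ ν (x / y) := by
    by_contra! hneg
    rw [← (ν).map_one, ← map_lt_map_mul_left_iff hy0, hxy, mul_one] at hneg
    exact hneg.not_ge hyx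
  obtain ⟨c, hc⟩ := h.exists_sub_algebraMap_pos (div_mem hx hy) hnonneg
  refine ⟨c, ?_⟩
  have hone := h.add_one_le_scaledOrd (k := 0)
    (sub_mem (div_mem hx hy) (L.algebraMap_mem (c : K))) (by simpa using hc)
  have hfactor : x - y * algebraMap K Ks c = y * (x / y - algebraMap K Ks c) := by
    rw [mul_sub, hxy]
  rw [hfactor, AddValuation.map_mul]
  gcongr
  simpa using hone

end IsPrimeElement

variable {p : ℕ} [Fact p.Prime] {m l s : ℕ} {t w : 𝒪} {y : Ks}

local notation "ν" => scaledOrd 𝒪 Ks p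

/-- `y` is a prime element of `L` and solves the equation of `IsAmanoRoot` up to an error whose
valuation exceeds that of the middle term `w t ^ m y ^ l` by at least `s`. -/
structure IsAmanoApprox (𝒪 : ValuationSubring K) [IsDiscreteValuationRing 𝒪]
    [IsAdicComplete (maximalIdeal 𝒪) 𝒪] (p m l : ℕ) [NeZero p] (L : IntermediateField K Ks)
    (s : ℕ) (t w : 𝒪) (y : Ks) : Prop
    extends IsAmanoDatum 𝒪 p m l t w, IsPrimeElement 𝒪 p L y where
  le_scaledOrd : ((m * p + l + s : ℚ) : WithTop ℚ) ≤ scaledOrd 𝒪 Ks p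
    (y ^ p - (algebraMap K Ks w * algebraMap K Ks t ^ m * y ^ l + algebraMap K Ks t))

namespace IsAmanoApprox

variable (h : IsAmanoApprox 𝒪 p m l L s t w y)

include h

theorem le_scaledOrd_pow_sub :
    ((m * p + l : ℚ) : WithTop ℚ) ≤ ν (y ^ p - algebraMap K Ks t) := by
  have hsplit : y ^ p - algebraMap K Ks t =
      (y ^ p - (algebraMap K Ks w * algebraMap K Ks t ^ m * y ^ l + algebraMap K Ks t)) +
        algebraMap K Ks w * algebraMap K Ks t ^ m * y ^ l := by ring
  rw [hsplit]
  refine (ν).map_le_add (le_trans ?_ h.le_scaledOrd) ?_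
  · rw [WithTop.coe_le_coe]
    exact le_add_of_nonneg_right s.cast_nonneg
  · rw [h.scaledOrd_middle_term (r := 1) h.scaledOrd_eq_one, mul_one]

theorem le_scaledOrd_improved [CharP K p] (hs : 1 ≤ s) (c : 𝒪)
    (hc : ((m * p + l + (s + 1) : ℚ) : WithTop ℚ) ≤
      ν (y ^ p - (algebraMap K Ks w * algebraMap K Ks t ^ m * y ^ l + algebraMap K Ks t) -
        l * (algebraMap K Ks w * algebraMap K Ks t ^ m * y ^ l) * y ^ s * algebraMap K Ks c)) :
    ((m * p + l + (s + 1) : ℚ) : WithTop ℚ) ≤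
      ν ((y * (1 + algebraMap K Ks c * y ^ s)) ^ p -
        (algebraMap K Ks w * (algebraMap K Ks t *
          (1 + algebraMap K Ks c ^ p * algebraMap K Ks t ^ s)) ^ m *
          (y * (1 + algebraMap K Ks c * y ^ s)) ^ l +
            algebraMap K Ks t * (1 + algebraMap K Ks c ^ p * algebraMap K Ks t ^ s))) := by
  have : CharP Ks p := charP_of_injective_algebraMap (algebraMap K Ks).injective p
  have hp : 2 ≤ p := (Fact.out : p.Prime).two_le
  have hp2 : (2 : ℚ) ≤ p := Nat.ofNat_le_cast.mpr hp
  have hs1 : (1 : ℚ) ≤ s := Nat.one_le_cast.mpr hs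
  have hE : 0 ≤ ν (algebraMap K Ks c) := (scaledOrd_algebraMap_nonneg_iff 𝒪 p).mpr c.2
  have hy (k : ℕ) : ν (y ^ k) = ((k : ℚ) : WithTop ℚ) := by
    rw [map_pow_of_eq_coe (r := 1) h.scaledOrd_eq_one, mul_one]
  have hε : ((s : ℚ) : WithTop ℚ) ≤ ν (algebraMap K Ks c * y ^ s) := by
    rw [AddValuation.map_mul, hy]
    exact le_add_of_nonneg_left hE
  have hε0 : 0 ≤ ν (algebraMap K Ks c * y ^ s) :=
    (WithTop.coe_le_coe.mpr s.cast_nonneg).trans hε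
  have hδ : 2 • ν (algebraMap K Ks c * y ^ s) ≤
      ν (algebraMap K Ks c ^ p * algebraMap K Ks t ^ s) := by
    have hpow : ν (algebraMap K Ks c ^ p * algebraMap K Ks t ^ s) =
        p • ν (algebraMap K Ks c * y ^ s) := by
      rw [AddValuation.map_mul, AddValuation.map_mul, nsmul_add, ← AddValuation.map_pow _ (y ^ s),
        ← pow_mul, hy, map_pow_of_eq_coe h.scaledOrd_prime, AddValuation.map_pow, Nat.cast_mul]
    rw [hpow]
    exact nsmul_le_nsmul_left hε0 hp
  rw [mul_one_add_pow_sub_eq]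
  refine (ν).map_le_sub ((ν).map_le_add hc ?_) ?_
  · have hpow := le_map_pow_succ_sub_pow_succ (hy p).ge h.scaledOrd_prime.ge s
    rw [AddValuation.map_mul, AddValuation.map_pow]
    refine le_add_of_nonneg_of_le (nsmul_nonneg hE p) (le_trans ?_ hpow)
    refine le_trans ?_ (add_le_add_right h.le_scaledOrd_pow_sub _)
    rw [← WithTop.coe_nsmul, ← WithTop.coe_add, WithTop.coe_le_coe, nsmul_eq_mul]
    nlinarith
  · rw [AddValuation.map_mul, h.scaledOrd_middle_term (r := 1) h.scaledOrd_eq_one]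
    refine le_trans ?_ (add_le_add_right ((nsmul_le_nsmul_right hε 2).trans
      (two_nsmul_le_map_one_add_pow_mul_sub hε0 hδ m l)) _)
    rw [← WithTop.coe_nsmul, ← WithTop.coe_add, WithTop.coe_le_coe, nsmul_eq_mul]
    push_cast
    linarith

theorem exists_improved [CharP K p] (hs : 1 ≤ s) :
    ∃ t' y', IsAmanoApprox 𝒪 p m l L (s + 1) t' w y' := by
  have : CharP Ks p := charP_of_injective_algebraMap (algebraMap K Ks).injective p
  set A := algebraMap K Ks w * algebraMap K Ks t ^ m * y ^ l
  have hN : ν (l * A * y ^ s) = ((m * p + l + s : ℚ) : WithTop ℚ) := by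
    rw [AddValuation.map_mul, AddValuation.map_mul,
      map_natCast_eq_zero p (Nat.not_dvd_of_pos_of_lt h.one_le_l h.l_lt),
      h.scaledOrd_middle_term (r := 1) h.scaledOrd_eq_one,
      map_pow_of_eq_coe (r := 1) h.scaledOrd_eq_one, zero_add, mul_one, mul_one, ← WithTop.coe_add]
  have hAL : A ∈ L := mul_mem (mul_mem (L.algebraMap_mem _) (pow_mem (L.algebraMap_mem _) m))
    (pow_mem h.mem l)
  obtain ⟨c, hc⟩ := h.exists_add_one_le_scaledOrd_sub_mul
    (x := y ^ p - (A + algebraMap K Ks t)) (y := l * A * y ^ s)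
    (sub_mem (pow_mem h.mem p) (add_mem hAL (L.algebraMap_mem _)))
    (mul_mem (mul_mem (natCast_mem L l) hAL) (pow_mem h.mem s))
    ((ν).ne_top_iff.mp (hN ▸ WithTop.coe_ne_top)) (hN ▸ h.le_scaledOrd)
  rw [hN, ← WithTop.coe_one, ← WithTop.coe_add, add_assoc] at hc
  have hE : 0 ≤ ν (algebraMap K Ks c) := (scaledOrd_algebraMap_nonneg_iff 𝒪 p).mpr c.2
  have hpos {x : Ks} {r : ℚ} (n : ℕ) (hr : 0 < r) (hx : ν x = r) :
      0 < ν (algebraMap K Ks c ^ n * x ^ s) := by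
    rw [AddValuation.map_mul, AddValuation.map_pow, map_pow_of_eq_coe hx]
    exact lt_add_of_nonneg_of_lt (nsmul_nonneg hE n) (WithTop.coe_lt_coe.mpr (by positivity))
  have hδ := map_one_add (hpos p (Nat.cast_pos.mpr (NeZero.pos p)) h.scaledOrd_prime)
  have hε := map_one_add (hpos 1 one_pos h.scaledOrd_eq_one)
  rw [pow_one] at hε
  refine ⟨t * (1 + c ^ p * t ^ s), y * (1 + algebraMap K Ks c * y ^ s),
    { h.toIsAmanoDatum with irreducible := ?_ }, ⟨h.finrank_eq, ?_, ?_⟩, ?_⟩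
  · rw [← scaledOrd_algebraMap_eq_natCast_iff (Ks := Ks) 𝒪 p]
    simp [h.scaledOrd_prime, hδ]
  · exact mul_mem h.mem (add_mem L.one_mem (mul_mem (L.algebraMap_mem _) (pow_mem h.mem s)))
  · rw [AddValuation.map_mul, hε, h.scaledOrd_eq_one, add_zero]
  · simpa using h.le_scaledOrd_improved hs c hc

omit h in
theorem exists_of_one [CharP K p] (h : IsAmanoApprox 𝒪 p m l L 1 t w y) (hs : 1 ≤ s) :
    ∃ t' y', IsAmanoApprox 𝒪 p m l L s t' w y' := by
  induction s, hs using Nat.le_induction with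
  | base => exact ⟨t, y, h⟩
  | succ s hs ih =>
    obtain ⟨t', y', h'⟩ := ih
    exact h'.exists_improved hs

end IsAmanoApprox

theorem IsAmanoApprox.rescale {W U : 𝒪} (h : IsAmanoApprox 𝒪 p m l L 1 t w y) {n : ℕ}
    (hn : n + p = m * p + l) (hW : IsUnit W) (hU : IsUnit U)
    (hmem : w - W * U ^ n ∈ maximalIdeal 𝒪) :
    IsAmanoApprox 𝒪 p m l L 1 (U ^ p * t) W (algebraMap K Ks U * y) := by
  have hνU : ν (algebraMap K Ks U) = 0 :=
    (scaledOrd_algebraMap_eq_zero_iff 𝒪 p hU.ne_zero).mpr hU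
  refine ⟨⟨(associated_unit_mul_right t (U ^ p) (hU.pow p)).irreducible h.irreducible, hW,
    h.one_le_m, h.one_le_l, h.l_lt⟩, ⟨h.finrank_eq, mul_mem (L.algebraMap_mem _) h.mem, ?_⟩, ?_⟩
  · rw [AddValuation.map_mul, hνU, h.scaledOrd_eq_one, zero_add]
  have hsplit : (algebraMap K Ks U * y) ^ p - (algebraMap K Ks W *
        algebraMap K Ks ((U ^ p * t : 𝒪) : K) ^ m * (algebraMap K Ks U * y) ^ l +
        algebraMap K Ks ((U ^ p * t : 𝒪) : K)) =
      algebraMap K Ks U ^ p * ((y ^ p -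
        (algebraMap K Ks w * algebraMap K Ks t ^ m * y ^ l + algebraMap K Ks t)) +
        algebraMap K Ks ((w - W * U ^ n : 𝒪) : K) * (algebraMap K Ks t ^ m * y ^ l)) := by
    have hpow : algebraMap K Ks U ^ n * algebraMap K Ks U ^ p =
        (algebraMap K Ks U ^ p) ^ m * algebraMap K Ks U ^ l := by
      rw [← pow_add, hn, pow_add, pow_mul']
    push_cast
    linear_combination (algebraMap K Ks W * algebraMap K Ks t ^ m * y ^ l) * hpow
  have hνw := h.add_one_le_scaledOrd (k := 0) (L.algebraMap_mem ((w - W * U ^ n : 𝒪) : K))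
    ((scaledOrd_algebraMap_pos_iff 𝒪 p).mpr hmem)
  rw [hsplit, AddValuation.map_mul, map_pow_of_eq_coe (r := 0) hνU, mul_zero, WithTop.coe_zero,
    zero_add]
  refine (ν).map_le_add h.le_scaledOrd ?_
  rw [AddValuation.map_mul, AddValuation.map_mul, map_pow_of_eq_coe h.scaledOrd_prime,
    map_pow_of_eq_coe (r := 1) h.scaledOrd_eq_one, mul_one, ← WithTop.coe_add, Nat.cast_one,
    add_comm _ (1 : ℚ), WithTop.coe_add]
  gcongr
  simpa using hνw

variable [CharP K p]

theorem IsAmanoRoot.mem_of_lt_scaledOrd_sub [IsGalois K Ks] {ρ : Ks}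
    (h : IsAmanoRoot 𝒪 p m l t w ρ) {n : ℕ} (hn : n + p = m * p + l) {b : ℚ}
    (hb : ((p : ℚ) - 1) * b = n) (hy : y ∈ L) (hlt : ((b + 1 : ℚ) : WithTop ℚ) < ν (ρ - y)) :
    ρ ∈ L :=
  mem_of_forall_map_conj_sub_lt (scaledOrd_algEquiv 𝒪 p) hy fun g hg =>
    (h.scaledOrd_sub (h.map g) hn hb hg).trans_lt hlt

theorem IsAmanoDatum.exists_root_of_lt [IsSepClosed Ks] (h : IsAmanoDatum 𝒪 p m l t w)
    {r : WithTop ℚ} (hlt : p • r < ν (y ^ p -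
      (algebraMap K Ks w * algebraMap K Ks t ^ m * y ^ l + algebraMap K Ks t))) :
    ∃ ρ, IsAmanoRoot 𝒪 p m l t w ρ ∧ r < ν (y - ρ) := by
  have hsplits : ((amanoTrinomial p (t : K) w m l).map (algebraMap K Ks)).Splits :=
    IsSepClosed.splits_codomain _ (separable_amanoTrinomial (by simpa using h.irreducible.ne_zero)
      (by simpa using h.isUnit.ne_zero) h.one_le_l (natCast_ne_zero_of_lt p h.one_le_l h.l_lt))
  have hprod := hsplits.eval_eq_prod_roots_of_monic ((monic_amanoTrinomial h.l_lt).map _) y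
  have hcard := hsplits.natDegree_eq_card_roots
  rw [natDegree_map, natDegree_amanoTrinomial h.l_lt] at hcard
  rw [eval_map_algebraMap, aeval_amanoTrinomial] at hprod
  rw [hprod] at hlt
  nth_rewrite 1 [hcard] at hlt
  obtain ⟨ρ, hρ, hρy⟩ := exists_lt_map_sub hlt
  have hroot := (mem_roots'.mp hρ).2
  rw [IsRoot, eval_map_algebraMap, aeval_amanoTrinomial, sub_eq_zero] at hroot
  exact ⟨ρ, ⟨h, hroot⟩, hρy⟩

theorem IsAmanoApprox.exists_root [IsSepClosed Ks] [IsGalois K Ks]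
    (h : IsAmanoApprox 𝒪 p m l L 1 t w y) :
    ∃ t' ρ, IsAmanoRoot 𝒪 p m l t' w ρ ∧ K⟮ρ⟯ = L := by
  obtain ⟨n, hn⟩ : ∃ n, n + p = m * p + l :=
    ⟨m * p + l - p, Nat.sub_add_cancel <| Nat.le_add_right_of_le <|
      Nat.le_mul_of_pos_left p h.one_le_m⟩
  obtain ⟨b, hb⟩ : ∃ b, ((p : ℚ) - 1) * b = n :=
    ⟨n / (p - 1), mul_div_cancel₀ _ <| sub_ne_zero.mpr <| Nat.cast_ne_one.mpr
      (Fact.out : p.Prime).ne_one⟩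
  obtain ⟨s, hs⟩ := exists_nat_gt (p * (b + 1))
  obtain ⟨t', y', h'⟩ := h.exists_of_one (Nat.le_add_left 1 s)
  obtain ⟨ρ, hρ, hlt⟩ := h'.exists_root_of_lt (r := ((b + 1 : ℚ) : WithTop ℚ)) <| by
    refine lt_of_lt_of_le ?_ h'.le_scaledOrd
    rw [← WithTop.coe_nsmul, nsmul_eq_mul, WithTop.coe_lt_coe]
    push_cast
    have := mul_nonneg (m.cast_nonneg : (0 : ℚ) ≤ m) (p.cast_nonneg)
    linarith [(l.cast_nonneg : (0 : ℚ) ≤ l)]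
  rw [AddValuation.map_sub_swap] at hlt
  exact ⟨t', ρ, hρ, IsPrimeElement.adjoin_eq
    ⟨h.finrank_eq, hρ.mem_of_lt_scaledOrd_sub hn hb h'.mem hlt, hρ.scaledOrd_eq_one⟩⟩

end Approximation

section DominantTerm

variable {K Ks : Type*} [Field K] [Field Ks] [Algebra K Ks] [Algebra.IsAlgebraic K Ks]
  {𝒪 : ValuationSubring K} [IsDiscreteValuationRing 𝒪] [IsAdicComplete (maximalIdeal 𝒪) 𝒪]
  {L : IntermediateField K Ks} {p : ℕ} [Fact p.Prime] {m l : ℕ} {π x : Ks}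

local notation "ν" => scaledOrd 𝒪 Ks p

namespace IsPrimeElement

variable (h : IsPrimeElement 𝒪 p L π) {a : ℕ → K}
  (hpow : π ^ p = ∑ i ∈ Finset.range p, algebraMap K Ks (a i) * π ^ i)

include h hpow

theorem pow_mul_div_sub_one_pow_eq [CharP K p] (g : Ks ≃ₐ[K] Ks) :
    π ^ p * (g π / π - 1) ^ p = ∑ i ∈ (Finset.range p).erase 0,
      algebraMap K Ks (a i) * π ^ i * ((1 + (g π / π - 1)) ^ i - 1) := by
  have : CharP Ks p := charP_of_injective_algebraMap (algebraMap K Ks).injective p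
  have hgπ : π * (g π / π) = g π := mul_div_cancel₀ _ h.ne_zero
  rw [Finset.sum_erase _ (by simp), ← mul_pow, mul_sub, hgπ, mul_one, sub_pow_char, ← map_pow,
    hpow, map_sum, ← Finset.sum_sub_distrib]
  refine Finset.sum_congr rfl fun i _ => ?_
  rw [add_sub_cancel, mul_sub, mul_assoc _ (π ^ i), ← mul_pow, hgπ, map_mul, map_pow,
    AlgEquiv.commutes, mul_one]

theorem exists_dominant_term [CharP K p] (g : Ks ≃ₐ[K] Ks) (hg : 0 < ν (g π / π - 1))
    (hgπ : g π ≠ π) : ∃ j ∈ (Finset.range p).erase 0,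
      ν (π ^ p * (g π / π - 1) ^ (p - 1)) = ν (algebraMap K Ks (a j) * π ^ j) ∧
      ∀ i ∈ (Finset.range p).erase 0, i ≠ j →
        ν (algebraMap K Ks (a j) * π ^ j) < ν (algebraMap K Ks (a i) * π ^ i) := by
  set ε := g π / π - 1 with hε
  have hε0 : ε ≠ 0 := by rwa [hε, sub_ne_zero, Ne, div_eq_one_iff_eq h.ne_zero]
  have heq := h.pow_mul_div_sub_one_pow_eq hpow g
  rw [← hε] at heq
  have hp := (Fact.out : p.Prime).one_lt
  obtain ⟨j, hj, hjmin⟩ := ((Finset.range p).erase 0).exists_min_image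
    (fun i => ν (algebraMap K Ks (a i) * π ^ i)) ⟨1, by simpa using hp⟩
  have hterm : algebraMap K Ks (a j) * π ^ j ≠ 0 := by
    intro hj0
    refine mul_ne_zero (pow_ne_zero p h.ne_zero) (pow_ne_zero p hε0)
      (heq.trans (Finset.sum_eq_zero fun i hi => ?_))
    have htop := hjmin i hi
    rw [hj0, AddValuation.map_zero, top_le_iff, AddValuation.top_iff] at htop
    rw [htop, zero_mul]
  have hdom (i : ℕ) (hi : i ∈ (Finset.range p).erase 0) (hij : i ≠ j) :
      ν (algebraMap K Ks (a j) * π ^ j) < ν (algebraMap K Ks (a i) * π ^ i) :=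
    (hjmin i hi).lt_of_ne fun hν => hij (h.eq_of_scaledOrd_term_eq
      ((_root_.map_ne_zero _).mp (left_ne_zero_of_mul hterm))
      (Finset.mem_range.mp (Finset.mem_of_mem_erase hj))
      (Finset.mem_range.mp (Finset.mem_of_mem_erase hi)) hν).symm
  have hj0 : ν (j : Ks) = 0 := by
    have : CharP Ks p := charP_of_injective_algebraMap (algebraMap K Ks).injective p
    rw [Finset.mem_erase, Finset.mem_range] at hj
    exact map_natCast_eq_zero p (Nat.not_dvd_of_pos_of_lt (Nat.pos_of_ne_zero hj.1) hj.2)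
  have hlead := sameLeadingTerm_sum_mul_one_add_pow_sub_one hj hj0 hε0 hg hterm
    fun i hi _ hij => hdom i hi hij
  rw [← heq, ← pow_sub_one_mul (NeZero.ne p) ε, ← mul_assoc, ← mul_assoc, mul_comm _ ε,
    mul_comm _ ε] at hlead
  refine ⟨j, hj, ?_, hdom⟩
  rw [(hlead.of_mul_left hε0).map_eq, AddValuation.map_mul, hj0, zero_add]

omit hpow

theorem scaledOrd_constantTerm_eq (hval : ν (π ^ p) < ν x) {d : K}
    (hlt : ν x < ν (π ^ p - (x + algebraMap K Ks d))) : ν (algebraMap K Ks d) = (p : ℚ) := by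
  have hsplit : π ^ p - algebraMap K Ks d = π ^ p - (x + algebraMap K Ks d) + x := by ring
  rw [← mul_one (p : ℚ), ← map_pow_of_eq_coe (r := 1) h.scaledOrd_eq_one]
  refine (ν).map_eq_of_lt_sub ?_
  rw [AddValuation.map_sub_swap, hsplit]
  exact (ν).map_lt_add (hval.trans hlt) hval

theorem exists_eq_unit_mul_pow {c d : K} (hd : ν (algebraMap K Ks d) = (p : ℚ))
    (hval : ν (algebraMap K Ks c * π ^ l) = ((m * p + l : ℚ) : WithTop ℚ)) :
    ∃ t w : 𝒪, Irreducible t ∧ IsUnit w ∧ (t : K) = d ∧ (w : K) * (t : K) ^ m = c := by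
  have hd0 : d ≠ 0 := by
    rintro rfl
    simp at hd
  have hw : ν (algebraMap K Ks (c / d ^ m)) = 0 := by
    rw [map_div₀, ← mul_div_mul_right _ _ (pow_ne_zero l h.ne_zero), AddValuation.map_div, hval,
      map_pow, AddValuation.map_mul, map_pow_of_eq_coe hd,
      map_pow_of_eq_coe (r := 1) h.scaledOrd_eq_one, mul_one, ← WithTop.coe_add,
      LinearOrderedAddCommGroupWithTop.sub_self_eq_zero_of_ne_top WithTop.coe_ne_top]
  have hw0 : c / d ^ m ≠ 0 := by
    intro hw0
    simp [hw0] at hw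
  let t : 𝒪 := ⟨d, (scaledOrd_algebraMap_nonneg_iff 𝒪 p).mp
    (hd ▸ WithTop.coe_le_coe.mpr p.cast_nonneg)⟩
  let w : 𝒪 := ⟨c / d ^ m, (scaledOrd_algebraMap_nonneg_iff 𝒪 p).mp hw.ge⟩
  exact ⟨t, w, (scaledOrd_algebraMap_eq_natCast_iff 𝒪 p).mp hd,
    (scaledOrd_algebraMap_eq_zero_iff 𝒪 p fun h0 => hw0 (congrArg Subtype.val h0)).mp hw,
    rfl, div_mul_cancel₀ _ (pow_ne_zero m hd0)⟩

theorem exists_isAmanoApprox_of_lt (hm : 1 ≤ m) (hl : 1 ≤ l) (hlp : l < p) {c d : K}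
    (hval : ν (algebraMap K Ks c * π ^ l) = ((m * p + l : ℚ) : WithTop ℚ))
    (hlt : ν (algebraMap K Ks c * π ^ l) <
      ν (π ^ p - (algebraMap K Ks c * π ^ l + algebraMap K Ks d))) :
    ∃ t w, IsAmanoApprox 𝒪 p m l L 1 t w π := by
  have hpos : ν (π ^ p) < ν (algebraMap K Ks c * π ^ l) := by
    rw [hval, map_pow_of_eq_coe (r := 1) h.scaledOrd_eq_one, mul_one]
    exact_mod_cast lt_add_of_le_of_pos (Nat.le_mul_of_pos_left p hm) hl
  obtain ⟨t, w, ht, hw, rfl, rfl⟩ :=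
    h.exists_eq_unit_mul_pow (h.scaledOrd_constantTerm_eq hpos hlt) hval
  have hle := h.add_one_le_scaledOrd (k := m * p + l) (sub_mem (pow_mem h.mem p)
    (add_mem (mul_mem (L.algebraMap_mem _) (pow_mem h.mem l)) (L.algebraMap_mem _)))
    (lt_of_eq_of_lt (by rw [hval]; norm_cast) hlt)
  rw [map_mul, map_pow] at hle
  exact ⟨t, w, ⟨ht, hw, hm, hl, hlp⟩, h, mod_cast hle⟩

end IsPrimeElement

end DominantTerm

section Break

variable {K Ks : Type*} [Field K] [Field Ks] [Algebra K Ks] [Normal K Ks]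
  {𝒪 : ValuationSubring K} [IsDiscreteValuationRing 𝒪] [IsAdicComplete (maximalIdeal 𝒪) 𝒪]
  {L : IntermediateField K Ks} {p : ℕ} [Fact p.Prime] {m l n : ℕ} {b : ℚ}

local notation "ν" => scaledOrd 𝒪 Ks p

theorem exists_algEquiv_apply_eq (σ : L →ₐ[K] Ks) (x : L) :
    ∃ g : Ks ≃ₐ[K] Ks, g x = σ x :=
  ⟨.ofBijective _ (AlgHom.normal_bijective K Ks Ks (σ.liftNormal Ks)), σ.liftNormal_commutes Ks x⟩

theorem exists_isPrimeElement_of_mem_extensionsWithBreak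
    (hL : L ∈ extensionsWithBreak Ks 𝒪 p b) :
    ∃ π, IsPrimeElement 𝒪 p L π ∧ ∃ g : Ks ≃ₐ[K] Ks, ν (g π / π - 1) = b := by
  obtain ⟨hfin, -, σ, -, π, hπ, hσ⟩ := hL
  rw [ordOf_eq_scaledOrd 𝒪 p hfin] at hπ hσ
  have hprime : IsPrimeElement 𝒪 p L (π : Ks) := ⟨hfin, π.2, hπ⟩
  obtain ⟨g, hg⟩ := exists_algEquiv_apply_eq σ π
  refine ⟨π, hprime, g, ?_⟩
  have hsub : g π / π - 1 = (g π - π) / (π : Ks) := by rw [sub_div, div_self hprime.ne_zero]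
  rw [hsub, AddValuation.map_div, hg, hσ, hπ, ← WithTop.coe_one,
    ← WithTop.LinearOrderedAddCommGroup.coe_sub, add_sub_cancel_right]

theorem exists_isAmanoApprox [CharP K p] (hL : L ∈ extensionsWithBreak Ks 𝒪 p b) (hm : 1 ≤ m)
    (hl : 1 ≤ l) (hlp : l < p) (hn : n + p = m * p + l) (hb : ((p : ℚ) - 1) * b = n) :
    ∃ t w π, IsAmanoApprox 𝒪 p m l L 1 t w π := by
  obtain ⟨π, hπ, g, hg⟩ := exists_isPrimeElement_of_mem_extensionsWithBreak hL
  have hp : (1 : ℚ) < p := Nat.one_lt_cast.mpr (Fact.out : p.Prime).one_lt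
  have hn0 : 0 < n := by have := Nat.le_mul_of_pos_left p hm; lia
  have hb0 : 0 < b := by
    rw [← mul_pos_iff_of_pos_left (sub_pos.mpr hp), hb]
    exact Nat.cast_pos.mpr hn0
  have hgπ : g π ≠ π := by
    intro heq
    rw [heq, div_self hπ.ne_zero, sub_self, AddValuation.map_zero] at hg
    exact WithTop.top_ne_coe hg
  obtain ⟨a, ha⟩ := hπ.exists_eq_sum (pow_mem hπ.mem p)
  obtain ⟨j, hj, hval, hdom⟩ :=
    hπ.exists_dominant_term ha g (hg ▸ WithTop.coe_lt_coe.mpr hb0) hgπ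
  have hterm : ν (algebraMap K Ks (a j) * π ^ j) = ((m * p + l : ℚ) : WithTop ℚ) := by
    rw [← hval, AddValuation.map_mul, map_pow_of_eq_coe (r := 1) hπ.scaledOrd_eq_one,
      map_pow_of_eq_coe hg, ← WithTop.coe_add, Nat.cast_pred (NeZero.pos p), hb, mul_one, add_comm]
    exact_mod_cast congrArg (fun k : ℕ => ((k : ℚ) : WithTop ℚ)) hn
  obtain ⟨t, ht⟩ := IsDiscreteValuationRing.exists_irreducible 𝒪
  have htm : ν (algebraMap K Ks ((t : K) ^ m) * π ^ l) = ((m * p + l : ℚ) : WithTop ℚ) := by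
    rw [map_pow, AddValuation.map_mul,
      map_pow_of_eq_coe ((scaledOrd_algebraMap_eq_natCast_iff 𝒪 p).mpr ht),
      map_pow_of_eq_coe (r := 1) hπ.scaledOrd_eq_one, mul_one, WithTop.coe_add]
  obtain rfl := hπ.eq_of_scaledOrd_term_eq (by simpa using pow_ne_zero m ht.ne_zero) hlp
    (Finset.mem_range.mp (Finset.mem_of_mem_erase hj)) (htm.trans hterm.symm)
  have hrest := map_lt_map_sum_range_sub (f := fun i => algebraMap K Ks (a i) * π ^ i)
    (NeZero.pos p) hj (hterm ▸ WithTop.coe_ne_top) hdom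
  rw [← ha, pow_zero, mul_one] at hrest
  obtain ⟨t, w, hw⟩ := hπ.exists_isAmanoApprox_of_lt hm hl hlp hterm hrest
  exact ⟨t, w, π, hw⟩

end Break

section PrimeField

theorem exists_natCast_map_lt_map_sub {F Γ : Type*} [Field F] [LinearOrderedAddCommGroupWithTop Γ]
    {v : AddValuation F Γ} {p : ℕ} [Fact p.Prime] [CharP F p] {x : F}
    (hx : SameLeadingTerm v (x ^ (p - 1)) 1) : ∃ j : ℕ, v x < v (x - j) := by
  have hp := (Fact.out : p.Prime).one_lt
  have hx0 : v x = 0 := by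
    have hval := hx.map_eq
    rw [v.map_pow, v.map_one] at hval
    rcases lt_trichotomy (v x) 0 with hneg | hzero | hpos
    · exact absurd hval (nsmul_neg hneg (Nat.sub_ne_zero_of_lt hp)).ne
    · exact hzero
    · exact absurd hval (nsmul_pos hpos (Nat.sub_ne_zero_of_lt hp)).ne'
  have hfactor : x ^ p - x = (x ^ (p - 1) - 1) * x := by
    rw [sub_mul, pow_sub_one_mul (NeZero.ne p), one_mul]
  have hpos : 0 < v (x ^ p - x) := by
    rw [hfactor, v.map_mul, hx0, add_zero]
    exact SameLeadingTerm.one_iff.mp hx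
  let := ZMod.algebra F p
  have hsplits := GaloisField.splits_zmod_X_pow_sub_X p
  have hmonic : (X ^ p - X : (ZMod p)[X]).Monic :=
    monic_X_pow_sub (by rw [degree_X]; exact_mod_cast hp)
  have hprod := (hsplits.map (algebraMap (ZMod p) F)).eval_eq_prod_roots_of_monic (hmonic.map _) x
  rw [eval_map_algebraMap, aeval_sub, map_pow, aeval_X, hsplits.roots_map] at hprod
  obtain ⟨a, ha, hxa⟩ := exists_lt_map_sub (v := v) (y := x) (B := 0)
    (S := (X ^ p - X : (ZMod p)[X]).roots.map (algebraMap (ZMod p) F))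
    (by rwa [nsmul_zero, ← hprod])
  obtain ⟨j, -, rfl⟩ := Multiset.mem_map.mp ha
  refine ⟨j.val, ?_⟩
  rwa [hx0, ← map_natCast (algebraMap (ZMod p) F), ZMod.natCast_zmod_val]

end PrimeField

theorem exists_ringEquiv_adjoin {K K' F F' : Type*} [Field K] [Field K'] [Field F] [Field F']
    [Algebra K F] [Algebra K' F'] {x : F} {x' : F'} (hx : IsIntegral K x) (hx' : IsIntegral K' x')
    (φ : K ≃+* K') (h : (minpoly K x).map (φ : K →+* K') = minpoly K' x') :
    ∃ σ : K⟮x⟯ ≃+* K'⟮x'⟯, ∀ a : K, σ (algebraMap K K⟮x⟯ a) = algebraMap K' K'⟮x'⟯ (φ a) := by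
  let e := AdjoinRoot.mapRingEquiv φ (minpoly K x) (minpoly K' x') (h ▸ Associated.refl _)
  refine ⟨(IntermediateField.adjoinRootEquivAdjoin K hx).symm.toRingEquiv.trans
    (e.trans (IntermediateField.adjoinRootEquivAdjoin K' hx').toRingEquiv), fun a => ?_⟩
  change IntermediateField.adjoinRootEquivAdjoin K' hx'
    (e ((IntermediateField.adjoinRootEquivAdjoin K hx).symm (algebraMap K K⟮x⟯ a))) = _
  rw [AlgEquiv.commutes, AdjoinRoot.coe_mapRingEquiv, AdjoinRoot.algebraMap_eq, AdjoinRoot.map_of,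
    ← AdjoinRoot.algebraMap_eq]
  exact AlgEquiv.commutes _ _

section Conjugates

variable {K Ks : Type*} [Field K] [Field Ks] [Algebra K Ks] [IsGalois K Ks]

theorem isGalois_adjoin_simple_iff {x : Ks} :
    IsGalois K K⟮x⟯ ↔ ∀ g : Ks ≃ₐ[K] Ks, g x ∈ K⟮x⟯ := by
  have hnormal : Normal K K⟮x⟯ ↔ ∀ g : Ks ≃ₐ[K] Ks, g x ∈ K⟮x⟯ := by
    rw [IntermediateField.normal_iff_forall_map_le']
    simp only [IntermediateField.adjoin_map, Set.image_singleton,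
      IntermediateField.adjoin_simple_le_iff, AlgEquiv.coe_toAlgHom]
  rw [← hnormal, isGalois_iff]
  exact and_iff_right inferInstance

variable {p : ℕ} [Fact p.Prime] [CharP K p] {𝒪 : ValuationSubring K} [IsDiscreteValuationRing 𝒪]
  [IsAdicComplete (maximalIdeal 𝒪) 𝒪] {m l n : ℕ} {t t' w w' : 𝒪} {ρ ρ' : Ks}

local notation "ν" => scaledOrd 𝒪 Ks p

theorem IsAmanoRoot.sameLeadingTerm_mul_pow (h : IsAmanoRoot 𝒪 p m l t w ρ)
    (h' : IsAmanoRoot 𝒪 p m l t' w' ρ') (hρ' : ρ' ∈ K⟮ρ⟯) (hn : n + p = m * p + l) :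
    SameLeadingTerm ν (algebraMap K Ks w' * ρ' ^ n) (algebraMap K Ks w * ρ ^ n) := by
  have hp : p.Prime := Fact.out
  have : CharP Ks p := charP_of_injective_algebraMap (algebraMap K Ks).injective p
  obtain ⟨g, hg⟩ := h.isPrimeElement.exists_algEquiv_ne hp.ne_one
  have hε := h.isPrimeElement.sameLeadingTerm_conj_div_sub_one hp.one_lt
    ⟨h.finrank_adjoin, hρ', h'.scaledOrd_eq_one⟩ g hg (h.scaledOrd_div_sub_one_pos (h.map g))
  have hgρ' : g ρ' ≠ ρ' := fun heq => hε.ne_zero_left (by rw [heq, div_self h'.ne_zero, sub_self])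
  exact .of_mul_left (natCast_ne_zero_of_lt p h.one_le_l h.l_lt)
    ((h'.sameLeadingTerm_div_sub_one_pow (h'.map g) hn hgρ').symm.trans
      ((hε.pow (p - 1)).trans (h.sameLeadingTerm_div_sub_one_pow (h.map g) hn hg)))

omit [IsGalois K Ks] in
theorem IsAmanoRoot.exists_natCast_eq_of_mem [Algebra.IsAlgebraic K Ks] {b : ℚ}
    (h : IsAmanoRoot 𝒪 p m l t w ρ) (h' : IsAmanoRoot 𝒪 p m l t w ρ') (hne : ρ' ≠ ρ)
    (hρ' : ρ' ∈ K⟮ρ⟯) (hn : n + p = m * p + l) (hb : ((p : ℚ) - 1) * b = n) : ∃ N : ℕ, b = N := by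
  have hε0 : ρ' / ρ - 1 ≠ 0 := by rwa [sub_ne_zero, Ne, div_eq_one_iff_eq h.ne_zero]
  obtain ⟨z, hz⟩ := h.isPrimeElement.exists_scaledOrd_eq_intCast
    (sub_mem (div_mem hρ' h.isPrimeElement.mem) (one_mem _)) hε0
  have hpos := h.scaledOrd_div_sub_one_pos h'
  have hbz := hz.symm.trans (h.scaledOrd_div_sub_one h' hn hb hne)
  rw [hz] at hpos
  lift z to ℕ using Int.cast_nonneg_iff.mp (WithTop.coe_pos.mp hpos).le
  exact ⟨z, (WithTop.coe_inj.mp hbz).symm⟩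

-- `A` is an approximation to `ρ' / ρ - 1` up to a factor in the prime field, so that Krasner's
-- lemma applies to `ρ'` and `ρ (1 + j A)` for a suitable `j`.
theorem IsAmanoRoot.mem_adjoin_of_sameLeadingTerm {A : Ks} (h : IsAmanoRoot 𝒪 p m l t w ρ)
    (h' : IsAmanoRoot 𝒪 p m l t w ρ') (hA : A ∈ K⟮ρ⟯) (hn : n + p = m * p + l)
    (hlead : SameLeadingTerm ν (A ^ (p - 1)) (l * (algebraMap K Ks w * ρ ^ n))) : ρ' ∈ K⟮ρ⟯ := by
  have : CharP Ks p := charP_of_injective_algebraMap (algebraMap K Ks).injective p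
  have hp := (Fact.out : p.Prime).one_lt
  rcases eq_or_ne ρ' ρ with rfl | hne
  · exact h.isPrimeElement.mem
  have hb : ((p : ℚ) - 1) * (n / (p - 1)) = n :=
    mul_div_cancel₀ _ (sub_ne_zero.mpr (Nat.cast_ne_one.mpr hp.ne'))
  have hA0 : A ≠ 0 := ne_zero_pow (Nat.sub_ne_zero_of_lt hp) hlead.ne_zero_left
  have hratio := ((h.sameLeadingTerm_div_sub_one_pow h' hn hne).trans hlead.symm).div
    (.refl (pow_ne_zero (p - 1) hA0))
  rw [div_self (pow_ne_zero _ hA0), ← div_pow] at hratio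
  obtain ⟨j, hj⟩ := exists_natCast_map_lt_map_sub hratio
  have hsub : ρ' - ρ = ρ * A * ((ρ' / ρ - 1) / A) := by
    field_simp [h.ne_zero]
  have hsubj : ρ' - ρ * (1 + j * A) = ρ * A * ((ρ' / ρ - 1) / A - j) := by
    field_simp [h.ne_zero]
    ring
  refine h'.mem_of_lt_scaledOrd_sub hn hb (y := ρ * (1 + j * A)) (mul_mem h.isPrimeElement.mem
    (add_mem (one_mem _) (mul_mem (natCast_mem _ j) hA))) ?_
  rw [← h.scaledOrd_sub h' hn hb hne, hsub, hsubj]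
  exact (map_lt_map_mul_left_iff (mul_ne_zero h.ne_zero hA0)).mpr hj

end Conjugates

section Classification

variable {K Ks : Type*} [Field K] [Field Ks] [Algebra K Ks] {p : ℕ} [Fact p.Prime] [CharP K p]
  {𝒪 : ValuationSubring K} [IsAdicComplete (maximalIdeal 𝒪) 𝒪] [PerfectField (ResidueField 𝒪)]

theorem teichmuller_natCast_mul (i : ℕ) (a : ResidueField 𝒪) :
    teichmuller p 𝒪 (i * a) = i * teichmuller p 𝒪 a := by
  change teichmullerHom p 𝒪 (i * a) = i * teichmullerHom p 𝒪 a
  rw [map_mul, map_natCast]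

theorem sub_teichmuller_mem_maximalIdeal (a : 𝒪) :
    a - teichmuller p 𝒪 (residue 𝒪 a) ∈ maximalIdeal 𝒪 := by
  rw [← residue_eq_zero_iff, map_sub, residue_teichmuller, sub_self]

variable [IsDiscreteValuationRing 𝒪] {L : IntermediateField K Ks} {m l n : ℕ} {b : ℚ} {t t' : 𝒪}
  {ρ ρ' : Ks}

theorem exists_isAmanoRoot_adjoin_eq [IsSepClosed Ks] [IsGalois K Ks]
    (hL : L ∈ extensionsWithBreak Ks 𝒪 p b) (hm : 1 ≤ m) (hl : 1 ≤ l) (hlp : l < p)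
    (hn : n + p = m * p + l) (hb : ((p : ℚ) - 1) * b = n) :
    ∃ ω₀ : (ResidueField 𝒪)ˣ, ∀ ω u : (ResidueField 𝒪)ˣ, ω * u ^ n = ω₀ →
      ∃ t ρ, IsAmanoRoot 𝒪 p m l t (teichmuller p 𝒪 ω) ρ ∧ K⟮ρ⟯ = L := by
  obtain ⟨t, w, π, h⟩ := exists_isAmanoApprox hL hm hl hlp hn hb
  refine ⟨(h.isUnit.map (residue 𝒪)).unit, fun ω u heq => ?_⟩
  have hw : (ω * u ^ n : ResidueField 𝒪) = residue 𝒪 w := congrArg Units.val heq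
  refine (h.rescale hn (ω.isUnit.map (teichmuller p 𝒪)) (u.isUnit.map (teichmuller p 𝒪))
    ?_).exists_root
  rw [← map_pow, ← map_mul, hw]
  exact sub_teichmuller_mem_maximalIdeal w

theorem IsAmanoRoot.exists_ringEquiv_apply {L' : IntermediateField K Ks} {a : ResidueField 𝒪}
    {y : L} (h : IsAmanoRoot 𝒪 p m l t (teichmuller p 𝒪 a) (y : Ks)) (σ : L ≃+* L') {φ : K ≃+* K}
    (hσ : ∀ x : K, σ (algebraMap K L x) = algebraMap K L' (φ x)) (hφ : FixesResidueField p 𝒪 φ) :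
    ∃ t', IsAmanoRoot 𝒪 p m l t' (teichmuller p 𝒪 a) (σ y : Ks) := by
  obtain ⟨t', ht', htt'⟩ := ringEquiv_map_irreducible 𝒪 p φ h.irreducible
  refine ⟨t', { h with irreducible := ht', pow_eq := ?_ }⟩
  have hy : y ^ p = algebraMap K L (teichmuller p 𝒪 a) * algebraMap K L t ^ m * y ^ l +
      algebraMap K L t := Subtype.ext h.pow_eq
  have hσy := congrArg (fun z => ((σ z : L') : Ks)) hy
  simpa [hσ, hφ a, ← htt'] using hσy

variable [Algebra.IsAlgebraic K Ks]

local notation "ν" => scaledOrd 𝒪 Ks p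

theorem eq_of_sameLeadingTerm_teichmuller {a c : ResidueField 𝒪}
    (h : SameLeadingTerm ν (algebraMap K Ks (teichmuller p 𝒪 a))
      (algebraMap K Ks (teichmuller p 𝒪 c))) : a = c := by
  have hpos := ((scaledOrd_algebraMap_nonneg_iff 𝒪 p).mpr (teichmuller p 𝒪 c).2).trans_lt h
  rw [← map_sub, ← AddSubgroupClass.coe_sub, scaledOrd_algebraMap_pos_iff, ← residue_eq_zero_iff,
    map_sub, residue_teichmuller, residue_teichmuller, sub_eq_zero] at hpos
  exact hpos

theorem IsPrimeElement.exists_sameLeadingTerm_teichmuller {π y : Ks}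
    (h : IsPrimeElement 𝒪 p L π) (hy : y ∈ L) (hy0 : ν y = 0) :
    ∃ u : (ResidueField 𝒪)ˣ,
      SameLeadingTerm ν y (algebraMap K Ks (teichmuller p 𝒪 (u : ResidueField 𝒪))) := by
  obtain ⟨c, hc⟩ := h.exists_sub_algebraMap_pos hy hy0.ge
  have hlt : ν y < ν (y - algebraMap K Ks (teichmuller p 𝒪 (residue 𝒪 c))) := by
    rw [hy0, ← sub_add_sub_cancel _ (algebraMap K Ks c)]
    refine (ν).map_lt_add hc ?_
    rw [← map_sub, ← AddSubgroupClass.coe_sub, scaledOrd_algebraMap_pos_iff]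
    exact sub_teichmuller_mem_maximalIdeal c
  have hu : residue 𝒪 c ≠ 0 := by
    intro h0
    have hpos := (scaledOrd_algebraMap_pos_iff (Ks := Ks) 𝒪 p).mpr ((residue_eq_zero_iff c).mp h0)
    have hy := (ν).map_lt_add hc hpos
    rw [sub_add_cancel, hy0] at hy
    exact hy.false
  refine ⟨Units.mk0 _ hu, SameLeadingTerm.symm ?_⟩
  rw [SameLeadingTerm, AddValuation.map_sub_swap]
  exact hlt

theorem IsAmanoRoot.isKIsomorphic_adjoin {a : ResidueField 𝒪}
    (h : IsAmanoRoot 𝒪 p m l t (teichmuller p 𝒪 a) ρ)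
    (h' : IsAmanoRoot 𝒪 p m l t' (teichmuller p 𝒪 a) ρ') : IsKIsomorphic p 𝒪 K⟮ρ⟯ K⟮ρ'⟯ := by
  obtain ⟨φ, hφt, hφ⟩ := exists_ringEquiv_map_prime p 𝒪 h.irreducible h'.irreducible
  have hmap : (minpoly K ρ).map (φ : K →+* K) = minpoly K ρ' := by
    simp [h.minpoly_eq, h'.minpoly_eq, amanoTrinomial, hφt, hφ a]
  obtain ⟨σ, hσ⟩ := exists_ringEquiv_adjoin (Algebra.IsIntegral.isIntegral ρ)
    (Algebra.IsIntegral.isIntegral ρ') φ hmap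
  exact ⟨σ, φ, hσ, hφ⟩

variable {ω ω' : (ResidueField 𝒪)ˣ}

theorem IsAmanoRoot.exists_eq_mul_pow_of_mem [IsGalois K Ks]
    (h : IsAmanoRoot 𝒪 p m l t (teichmuller p 𝒪 ω) ρ)
    (h' : IsAmanoRoot 𝒪 p m l t' (teichmuller p 𝒪 ω') ρ') (hρ' : ρ' ∈ K⟮ρ⟯)
    (hn : n + p = m * p + l) : ∃ u : (ResidueField 𝒪)ˣ, ω = ω' * u ^ n := by
  have hdiv : ν (ρ' / ρ) = 0 := by
    rw [AddValuation.map_div, h.scaledOrd_eq_one, h'.scaledOrd_eq_one,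
      LinearOrderedAddCommGroupWithTop.sub_self_eq_zero_of_ne_top WithTop.one_ne_top]
  obtain ⟨u, hu⟩ := h.isPrimeElement.exists_sameLeadingTerm_teichmuller
    (div_mem hρ' h.isPrimeElement.mem) hdiv
  have hρn := pow_ne_zero n h.ne_zero
  have hlead := (h.sameLeadingTerm_mul_pow h' hρ' hn).div (.refl hρn)
  rw [mul_div_cancel_right₀ _ hρn, mul_div_assoc, ← div_pow] at hlead
  have hω' : algebraMap K Ks (teichmuller p 𝒪 (ω' : ResidueField 𝒪)) ≠ 0 := by
    simpa using h'.isUnit.ne_zero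
  refine ⟨u, Units.ext (eq_of_sameLeadingTerm_teichmuller (Ks := Ks) ?_)⟩
  simpa using hlead.symm.trans ((hu.pow n).mul_left hω')

theorem exists_eq_mul_pow_of_isKIsomorphic [IsGalois K Ks]
    (h : IsAmanoRoot 𝒪 p m l t (teichmuller p 𝒪 ω) ρ)
    (h' : IsAmanoRoot 𝒪 p m l t' (teichmuller p 𝒪 ω') ρ') (hn : n + p = m * p + l)
    (hiso : IsKIsomorphic p 𝒪 K⟮ρ⟯ K⟮ρ'⟯) : ∃ u : (ResidueField 𝒪)ˣ, ω' = ω * u ^ n := by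
  obtain ⟨σ, φ, hσ, hφ⟩ := hiso
  obtain ⟨s, hs⟩ :=
    h.exists_ringEquiv_apply (y := IntermediateField.AdjoinSimple.gen K ρ) σ hσ hφ
  exact h'.exists_eq_mul_pow_of_mem hs (σ _).2 hn

theorem IsAmanoRoot.exists_pow_eq_natCast_mul_of_mem {N : ℕ}
    (h : IsAmanoRoot 𝒪 p m l t (teichmuller p 𝒪 ω) ρ)
    (h' : IsAmanoRoot 𝒪 p m l t (teichmuller p 𝒪 ω) ρ') (hne : ρ' ≠ ρ) (hρ' : ρ' ∈ K⟮ρ⟯)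
    (hn : N * (p - 1) + p = m * p + l) :
    ∃ c : (ResidueField 𝒪)ˣ, (c : ResidueField 𝒪) ^ (p - 1) = l * ω := by
  have hb : ((p : ℚ) - 1) * N = (N * (p - 1) : ℕ) := by
    rw [Nat.cast_mul, Nat.cast_pred (NeZero.pos p), mul_comm]
  have hdiv : ν ((ρ' / ρ - 1) / ρ ^ N) = 0 := by
    rw [AddValuation.map_div, h.scaledOrd_div_sub_one h' hn hb hne,
      map_pow_of_eq_coe (r := 1) h.scaledOrd_eq_one, mul_one,
      LinearOrderedAddCommGroupWithTop.sub_self_eq_zero_of_ne_top WithTop.coe_ne_top]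
  have hρ := h.isPrimeElement.mem
  obtain ⟨c, hc⟩ := h.isPrimeElement.exists_sameLeadingTerm_teichmuller
    (div_mem (sub_mem (div_mem hρ' hρ) (one_mem _)) (pow_mem hρ N)) hdiv
  have hρn := pow_ne_zero (N * (p - 1)) h.ne_zero
  have hlead := (h.sameLeadingTerm_div_sub_one_pow h' hn hne).div (.refl hρn)
  rw [← mul_assoc, mul_div_cancel_right₀ _ hρn, pow_mul, ← div_pow] at hlead
  refine ⟨c, eq_of_sameLeadingTerm_teichmuller (Ks := Ks) ?_⟩
  rw [teichmuller_natCast_mul]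
  simpa using (hc.pow (p - 1)).symm.trans hlead

theorem IsAmanoRoot.mem_adjoin_of_pow_eq [IsGalois K Ks] {N : ℕ} {c : ResidueField 𝒪}
    (h : IsAmanoRoot 𝒪 p m l t (teichmuller p 𝒪 ω) ρ)
    (h' : IsAmanoRoot 𝒪 p m l t (teichmuller p 𝒪 ω) ρ') (hn : N * (p - 1) + p = m * p + l)
    (hc : c ^ (p - 1) = l * ω) : ρ' ∈ K⟮ρ⟯ := by
  have : CharP Ks p := charP_of_injective_algebraMap (algebraMap K Ks).injective p
  have hτ : algebraMap K Ks (teichmuller p 𝒪 c) ^ (p - 1) =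
      l * algebraMap K Ks (teichmuller p 𝒪 (ω : ResidueField 𝒪)) := by
    rw [← map_pow, ← SubmonoidClass.coe_pow, ← map_pow, hc, teichmuller_natCast_mul]
    simp
  have hpow : (algebraMap K Ks (teichmuller p 𝒪 c) * ρ ^ N) ^ (p - 1) =
      l * (algebraMap K Ks (teichmuller p 𝒪 (ω : ResidueField 𝒪)) * ρ ^ (N * (p - 1))) := by
    rw [mul_pow, hτ, pow_mul, mul_assoc]
  have hl : (l : Ks) ≠ 0 := natCast_ne_zero_of_lt p h.one_le_l h.l_lt
  have hω : algebraMap K Ks (teichmuller p 𝒪 (ω : ResidueField 𝒪)) ≠ 0 := by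
    simpa using h.isUnit.ne_zero
  refine h.mem_adjoin_of_sameLeadingTerm (A := algebraMap K Ks (teichmuller p 𝒪 c) * ρ ^ N) h'
    (mul_mem (IntermediateField.algebraMap_mem _ _) (pow_mem h.isPrimeElement.mem N)) hn ?_
  rw [hpow]
  exact .refl (mul_ne_zero hl (mul_ne_zero hω (pow_ne_zero _ h.ne_zero)))

theorem IsAmanoRoot.isGalois_adjoin_iff [IsGalois K Ks]
    (h : IsAmanoRoot 𝒪 p m l t (teichmuller p 𝒪 ω) ρ) (hn : n + p = m * p + l)
    (hpn : ¬p ∣ n) (hb : ((p : ℚ) - 1) * b = n) :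
    IsGalois K K⟮ρ⟯ ↔ (∃ N : ℕ, ¬p ∣ N ∧ b = N) ∧
      ∃ c : (ResidueField 𝒪)ˣ, (c : ResidueField 𝒪) ^ (p - 1) = l * ω := by
  have hbreak {N : ℕ} (hN : b = N) : n = N * (p - 1) := by
    rw [hN, ← Nat.cast_pred (NeZero.pos p)] at hb
    exact_mod_cast hb.symm.trans (mul_comm _ _)
  rw [isGalois_adjoin_simple_iff]
  constructor
  · intro hmem
    obtain ⟨g, hg⟩ := h.isPrimeElement.exists_algEquiv_ne (Fact.out : p.Prime).ne_one
    obtain ⟨N, hN⟩ := h.exists_natCast_eq_of_mem (h.map g) hg (hmem g) hn hb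
    obtain rfl := hbreak hN
    exact ⟨⟨N, fun hpN => hpn (hpN.mul_right _), hN⟩,
      h.exists_pow_eq_natCast_mul_of_mem (h.map g) hg (hmem g) hn⟩
  · rintro ⟨⟨N, -, hN⟩, c, hc⟩ g
    exact h.mem_adjoin_of_pow_eq (h.map g) (hbreak hN ▸ hn) hc

end Classification

section Exponent

theorem add_eq_mul_add_of_break_eq {p : ℕ} (hp : 1 < p) {b : ℚ} {n m l : ℕ}
    (hb : ((p : ℚ) - 1) * b = n) (hbml : b = (((m : ℚ) - 1) * p + l) / ((p : ℚ) - 1)) :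
    n + p = m * p + l := by
  rw [hbml, mul_div_cancel₀ _ (sub_ne_zero.mpr (Nat.cast_ne_one.mpr hp.ne'))] at hb
  exact_mod_cast show (n + p : ℚ) = m * p + l by rw [← hb]; ring

end Exponent

end LocalFieldExt

theorem theorem1 {K Ks : Type*} [Field K] [Field Ks] [Algebra K Ks] [IsSepClosure K Ks]
    (p : ℕ) [Fact p.Prime] [CharP K p]
    -- `K` is a local field of characteristic `p` with perfect residue field, `πK` a prime element
    (𝒪 : ValuationSubring K) [IsDiscreteValuationRing 𝒪] [IsAdicComplete (maximalIdeal 𝒪) 𝒪]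
    [PerfectField (ResidueField 𝒪)] (πK : 𝒪) (hπK : Irreducible πK)
    -- `n = (p - 1) b` is a natural number that is not a multiple of `p`
    (b : ℚ) (n : ℕ) (hpn : ¬ p ∣ n) (hb : ((p : ℚ) - 1) * b = n)
    (m l : ℕ) (hl : 1 ≤ l) (hlp : l ≤ p - 1)
    (hbml : b = (((m : ℚ) - 1) * p + l) / ((p : ℚ) - 1))
    -- `R` is a set of coset representatives for `k^× / (k^×)^((p - 1) b)`
    (R : Set (ResidueField 𝒪)ˣ)
    (hR : Subgroup.IsComplement R
      ((powMonoidHom n : (ResidueField 𝒪)ˣ →* (ResidueField 𝒪)ˣ).range : Set (ResidueField 𝒪)ˣ))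
    (π : R → Ks)
    (hπ : ∀ ω : R, aeval (π ω) (LocalFieldExt.amanoPolynomial p πK m l ω.1) = 0) :
    (∃ hE : ∀ ω : R, K⟮π ω⟯ ∈ LocalFieldExt.extensionsWithBreak Ks 𝒪 p b,
      Function.Bijective (fun ω : R =>
        (Quotient.mk _ ⟨K⟮π ω⟯, hE ω⟩ : LocalFieldExt.KIsoClasses Ks p 𝒪 b))) ∧
    ∀ ω : R, IsGalois K K⟮π ω⟯ ↔
      (∃ N : ℕ, ¬ p ∣ N ∧ b = N) ∧
        ∃ c : (ResidueField 𝒪)ˣ, (c : ResidueField 𝒪) ^ (p - 1) = (l : ResidueField 𝒪) * ω.1 := by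
  have hlt : l < p := Nat.lt_of_le_pred (NeZero.pos p) hlp
  have hn := LocalFieldExt.add_eq_mul_add_of_break_eq (Fact.out : p.Prime).one_lt hb hbml
  have hm : 1 ≤ m := Nat.one_le_iff_ne_zero.mpr (by rintro rfl; lia)
  have : IsSepClosed Ks := IsSepClosure.sep_closed K
  have : IsGalois K Ks := inferInstance
  have hroot (ω : R) : LocalFieldExt.IsAmanoRoot 𝒪 p m l πK (LocalFieldExt.teichmuller p 𝒪 ω.1)
      (π ω) :=
    ⟨⟨hπK, ω.1.isUnit.map (LocalFieldExt.teichmuller p 𝒪), hm, hl, hlt⟩,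
      sub_eq_zero.mp ((LocalFieldExt.aeval_amanoTrinomial _).symm.trans (hπ ω))⟩
  refine ⟨⟨fun ω => (hroot ω).mem_extensionsWithBreak hn hb, fun ω₁ ω₂ heq => ?_, fun x => ?_⟩,
    fun ω => (hroot ω).isGalois_adjoin_iff hn hpn hb⟩
  · obtain ⟨u, hu⟩ := LocalFieldExt.exists_eq_mul_pow_of_isKIsomorphic (hroot ω₁) (hroot ω₂) hn
      (Quotient.exact heq)
    exact congrArg Prod.fst
      (@hR.1 (ω₁, ⟨u ^ n, ⟨u, rfl⟩⟩) (ω₂, ⟨1, one_mem _⟩) (by simp [hu]))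
  · obtain ⟨⟨L, hL⟩, rfl⟩ := Quotient.exists_rep x
    obtain ⟨ω₀, hω₀⟩ := LocalFieldExt.exists_isAmanoRoot_adjoin_eq hL hm hl hlt hn hb
    obtain ⟨⟨ω, _, u, rfl⟩, hω⟩ := hR.2 ω₀
    obtain ⟨t, ρ, hρ, rfl⟩ := hω₀ ω u hω
    exact ⟨ω, Quotient.sound ((hroot ω).isKIsomorphic_adjoin hρ)⟩
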